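/- **Setting.** All vectors carry the Euclidean norm; $\|\cdot\|_2$ on matrices is the operator norm and $\|\cdot\|_F$ the Frobenius norm. Let $A\in\mathbb R^{d\times d}$, $B\in\mathbb R^{d\times n}$, $C\in\mathbb R^{m\times d}$. The linear dynamical system $(A,B,C)$ maps inputs $x_1,\dots,x_T\in\mathbb R^n$ to outputs $y_t=Ch_t\in\mathbb R^m$, where $h_0=0$ and $h_t=Ah_{t-1}+Bx_t$. Set $x_s=0$, $y_s=0$ for $s\le 0$. Write $\ln^+ s=\max(0,\ln s)$ for $s>0$ and $\ln^+0=0$. *Wavefilters.* Let $\sigma_1\ge\dots\ge\sigma_T$ and $\phi_1,\dots,\phi_T\in\mathbb R^T$ be the eigenvalues and an orthonormal system of corresponding eigenvectors of the $T\times T$ Hankel matrix with entries $\frac{2}{(i+j)^3-(i+j)}$, $1\le i,j\le T$. *Pseudo-LDS.* For $0\le k\le T$, $W\ge 0$ and $\tau\ge0$, a pseudo-LDS $(M,N,e,P)$ consists of $e\in\mathbb R^\tau$, matrices $P_0,\dots,P_{\tau-1}\in\mathbb R^{m\times n}$, and matrices $M(p,h),N(p,h)\in\mathbb R^{m\times n}$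 for $0\le p<W$, $1\le h\le k$. Its prediction at time $t$ is $$\hat y_t=\sum_{u=1}^{\tau}e_u y_{t-u}+\sum_{j=0}^{\tau-1}P_jx_{t-j}+\sum_{p=0}^{W-1}\sum_{h=1}^{k}\sum_{u=1}^{T}\sigma_h^{1/4}\phi_h(u)\Big(\cos\!\big(\tfrac{2\pi up}{W}\big)M(p,h)+\sin\!\big(\tfrac{2\pi up}{W}\big)N(p,h)\Big)x_{t-\tau+1-u}.$$ Put $\|M\|_{2,1}=\sum_{p}\big(\sum_h\|M(p,h)\|_F^2\big)^{1/2}$, and likewise for $N$. **Theorem.** There is an absolute constant $K>0$ such that the following holds. Suppose that $A=\Psi\Lambda\Psi^{-1}$ with $\Psi\in\mathbb C^{d\times d}$ invertible and $\Lambda$ diagonal, that $A$ has spectral radius $\le1$, and that the diagonal entries of $\Lambda$ are written $\alpha_\ell=\omega_\ell r_\ell$ with $|\omega_\ell|=1$, $r_\ell\ge0$ $(1\le\ell\le d)$. Let $p(x)=\sum_{j=0}^{\tau}c_jx^{\tau-j}$ be a monic real polynomial of degree $\tau$ with $p(\omega_\ell)=0$ for every $\ell$. Suppose $\sum_{j=0}^\tau|c_j|\le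 R_1$, $\|B\|_2,\|C\|_2\le R_\Theta$, $\|\Psi\|_F\|\Psi^{-1}\|_F\le R_\Psi$, and let $R_x\ge0$, $\varepsilon>0$. Then there are $k\le T$, $W$ and a pseudo-LDS $(M,N,e,P)$ with $k$ filters and $W$ phases such that $$k\le K\,\ln T\;\ln^+\!\Big(\frac{\tau R_\Theta^2R_\Psi R_1R_xT}{\varepsilon}\Big),\qquad W\le K\,\frac{\tau R_\Theta^2R_\Psi R_1R_xT^{3/2}}{\varepsilon},$$ and moreover $$k\le K\,\ln T\;\ln^+\!\Big(\frac{\tau R_\Theta R_\Psi R_1R_xT}{\varepsilon}\Big)\quad\text{if }\varepsilon\le\tau R_\Psi R_1R_xT,$$ $$\|e\|_1\le R_1,\qquad \|P_j\|_F\le R_1R_\Theta^2R_\Psi\ (0\le j<\tau),\qquad \sqrt{\|M\|_{2,1}^2+\|N\|_{2,1}^2}\le K\,R_\Theta^2R_\Psi R_1\,\tau\sqrt k,$$ and such that for all inputs $x_1,\dots,x_T$ with $\|x_t\|_2\le R_x$ $(1\le t\le T)$, with $y_t$ the outputs of the system, $$\|\hat y_t-y_t\|_2\le\varepsilon\qquad(1\le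 t\le T).$$ (For $T=0$ the term $\ln T$ is read as $0$.) -/

import Mathlib

open scoped Matrix
open Finset

noncomputable section

/-- Frobenius norm of a real or complex matrix. -/
def frobNorm {𝕜 : Type*} [RCLike 𝕜] {a b : ℕ} (X : Matrix (Fin a) (Fin b) 𝕜) : ℝ :=
  Real.sqrt (∑ i, ∑ j, ‖X i j‖ ^ 2)

/-- Operator norm of a real matrix with respect to the Euclidean norms. -/
def opNorm2 {a b : ℕ} (X : Matrix (Fin a) (Fin b) ℝ) : ℝ :=
  ‖LinearMap.toContinuousLinearMap (Matrix.toEuclideanLin X)‖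

/-- Sum of the absolute values of the coefficients of a real polynomial. -/
def polyL1 (p : Polynomial ℝ) : ℝ :=
  ∑ i ∈ range (p.natDegree + 1), |p.coeff i|

/-- The norm `‖M‖_{2,1} = ∑_p (∑_h ‖M(p,h,:,:)‖_F²)^{1/2}` of a 4-tensor. -/
def tensorNorm21 {W k m n : ℕ} (M : Fin W → Fin k → Matrix (Fin m) (Fin n) ℝ) : ℝ :=
  ∑ p, Real.sqrt (∑ h, frobNorm (M p h) ^ 2)

/-- Hidden states of the linear dynamical system `h_0 = 0`, `h_t = A h_{t-1} + B x_t`. -/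
def ldsState {d n : ℕ} (A : Matrix (Fin d) (Fin d) ℝ) (B : Matrix (Fin d) (Fin n) ℝ)
    (x : ℕ → EuclideanSpace ℝ (Fin n)) : ℕ → EuclideanSpace ℝ (Fin d)
  | 0 => 0
  | t + 1 => Matrix.toEuclideanLin A (ldsState A B x t) + Matrix.toEuclideanLin B (x (t + 1))

/-- Outputs `y_t = C h_t` of the linear dynamical system. -/
def ldsOutput {d n m : ℕ} (A : Matrix (Fin d) (Fin d) ℝ) (B : Matrix (Fin d) (Fin n) ℝ)
    (C : Matrix (Fin m) (Fin d) ℝ) (x : ℕ → EuclideanSpace ℝ (Fin n)) (t : ℕ) :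
    EuclideanSpace ℝ (Fin m) :=
  Matrix.toEuclideanLin C (ldsState A B x t)

/-- The Hankel matrix with entries `2 / ((i+j)³ - (i+j))`, `1 ≤ i, j ≤ T`. -/
def waveHankel (T : ℕ) : Matrix (Fin T) (Fin T) ℝ :=
  fun i j => 2 / ((((i : ℕ) : ℝ) + 1 + (((j : ℕ) : ℝ) + 1)) ^ 3
    - (((i : ℕ) : ℝ) + 1 + (((j : ℕ) : ℝ) + 1)))

/-- `(σ_h, φ_h)` is an orthonormal eigensystem of the Hankel matrix, with the eigenvalues in
decreasing order: the `φ_h` are the wavefilters. -/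
structure IsWaveFilters (T : ℕ) (σ : Fin T → ℝ) (φ : Fin T → EuclideanSpace ℝ (Fin T)) :
    Prop where
  antitone : Antitone σ
  orthonormal : Orthonormal ℝ φ
  eigen : ∀ h, Matrix.toEuclideanLin (waveHankel T) (φ h) = σ h • φ h

theorem waveHankel_isHermitian (T : ℕ) : (waveHankel T).IsHermitian := by
  ext i j
  simp only [Matrix.conjTranspose_apply, waveHankel, star_trivial]
  rw [add_comm (((j : ℕ) : ℝ) + 1)]

theorem exists_isWaveFilters (T : ℕ) : ∃ σ φ, IsWaveFilters T σ φ := by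
  have hZ := waveHankel_isHermitian T
  let e : Fin T ≃ Fin T :=
    (finCongr (Fintype.card_fin T).symm).trans
      (Fintype.equivOfCardEq (Fintype.card_fin (Fintype.card (Fin T))))
  refine ⟨fun h => hZ.eigenvalues (e h), fun h => hZ.eigenvectorBasis (e h), ?_, ?_, ?_⟩
  · intro a b hab
    simp only [Matrix.IsHermitian.eigenvalues, e, Equiv.trans_apply, Equiv.symm_apply_apply]
    exact hZ.eigenvalues₀_antitone hab
  · exact hZ.eigenvectorBasis.orthonormal.comp e e.injective
  · intro h
    rw [Matrix.toLpLin_apply, hZ.mulVec_eigenvectorBasis]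
    rfl

/-- The value `z_{t-j}` of a sequence `z_1, z_2, …`, with the convention `z_s = 0` for `s ≤ 0`. -/
def delayed {E : Type*} [Zero E] (z : ℕ → E) (t j : ℕ) : E :=
  if j < t then z (t - j) else 0

/-- A pseudo-LDS with `k` filters, `W` phases, `τ` autoregressive terms, inputs in `ℝⁿ` and
outputs in `ℝᵐ`. -/
structure PseudoLDS (W k τ m n : ℕ) where
  M : Fin W → Fin k → Matrix (Fin m) (Fin n) ℝ
  N : Fin W → Fin k → Matrix (Fin m) (Fin n) ℝ
  e : Fin τ → ℝ
  P : Fin τ → Matrix (Fin m) (Fin n) ℝ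

/-- `∑_{u=1}^T a_u x_{t-τ+1-u}`: the convolution of the weights `a_1, …, a_T` with the inputs
delayed by `τ`, the first weight being the one of `x_{t-τ}`. The 1-based index `u` of this sum is
`u + 1` here. -/
def delayedConv {T n : ℕ} (a : Fin T → ℝ) (x : ℕ → EuclideanSpace ℝ (Fin n)) (t τ : ℕ) :
    EuclideanSpace ℝ (Fin n) :=
  ∑ u : Fin T, a u • delayed x t (τ + u)

/-- The prediction of a pseudo-LDS at time `t` from past outputs `y` and inputs `x`:
`∑_{u=1}^τ e_u y_{t-u} + ∑_{j=0}^{τ-1} P_j x_{t-j} + ∑_{p=0}^{W-1} ∑_{h=1}^k σ_h^{1/4}`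
`(M(p,h) ∑_{u=1}^T φ_h(u) cos(2πup/W) x_{t-τ+1-u} + N(p,h) ∑_{u=1}^T φ_h(u) sin(2πup/W)`
`x_{t-τ+1-u})`. -/
def PseudoLDS.predict {W k τ m n T : ℕ} (Θ : PseudoLDS W k τ m n) (hk : k ≤ T)
    (σ : Fin T → ℝ) (φ : Fin T → EuclideanSpace ℝ (Fin T))
    (x : ℕ → EuclideanSpace ℝ (Fin n)) (y : ℕ → EuclideanSpace ℝ (Fin m)) (t : ℕ) :
    EuclideanSpace ℝ (Fin m) :=
  ∑ u : Fin τ, Θ.e u • delayed y t (u + 1)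
  + ∑ j : Fin τ, Matrix.toEuclideanLin (Θ.P j) (delayed x t j)
  + ∑ p : Fin W, ∑ h : Fin k, σ (Fin.castLE hk h) ^ (1 / 4 : ℝ) •
      (Matrix.toEuclideanLin (Θ.M p h)
        (delayedConv (fun u : Fin T => φ (Fin.castLE hk h) u *
          Real.cos (2 * Real.pi * (((u : ℕ) : ℝ) + 1) * ((p : ℕ) : ℝ) / (W : ℝ))) x t τ)
      + Matrix.toEuclideanLin (Θ.N p h)
        (delayedConv (fun u : Fin T => φ (Fin.castLE hk h) u *
          Real.sin (2 * Real.pi * (((u : ℕ) : ℝ) + 1) * ((p : ℕ) : ℝ) / (W : ℝ))) x t τ))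

end

/-! Unrolling the dynamics gives `y_t = ∑ C A^s B x_{t-s}`. Taking the combination of `y_t, …,
y_{t-τ}` with the coefficients of `p` turns this into a convolution whose first `τ` weights are
stored exactly as the `P_j`, and whose weight at delay `τ + s` is `C A^s p(A) B`, that is, a sum
over eigenvalues `α = ω r` of `α^s p(α)` times a rank-one matrix. Since `p(ω) = 0`, `p(ω r)` is at
most `polyL1 p * τ * (1 - r)` in norm. Each mode is therefore a bounded matrix times `ω^s (1 - r)
r^s`: a phase times an entry of `geomVec T r`. These facts are `map_arWeight_add`,
`norm_aeval_mul_le` and `arWeight_add_eq_re`.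

The phase is replaced by a nearby `W`-th root of unity, at a cost proportional to `T / W`. The
vector `geomVec T r` is replaced by its projection on the first `k` filters. The Hankel matrix is
the integral over `[0, 1]` of `geomVec T r` times its transpose, so a small eigenvalue makes `⟨φ,
geomVec T r⟩` small in mean square over `r`; a Lipschitz estimate makes it small for every `r`, with
fourth power at most `12 σ` (`inner_geomVec_pow_four_le`).

The eigenvalues decay because Taylor expansion with `q` terms around about `log T` dyadic points
approximates every `geomVec T r` with error exponentially small in `q`; the min-max principle then
bounds `σ` beyond index `q (L + 1)` (`IsWaveFilters.eigenvalue_le`).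
`IsWaveFilters.exists_filterWeight_near` combines filters and phases, and the parameters are chosen
so that each of the two errors contributes `ε / 2`. -/

noncomputable section

/-! ### The Hankel matrix as an integral of rank-one matrices, and pointwise bounds from its
eigenvalues. -/

/-- The vector `(1 - r) (1, r, …, r^{T-1})`. -/
def geomVec (T : ℕ) (r : ℝ) : EuclideanSpace ℝ (Fin T) :=
  WithLp.toLp 2 fun u => (1 - r) * r ^ (u : ℕ)

@[simp] theorem geomVec_apply (T : ℕ) (r : ℝ) (u : Fin T) :
    geomVec T r u = (1 - r) * r ^ (u : ℕ) := rfl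

theorem geomVec_one (T : ℕ) : geomVec T 1 = 0 := by
  ext u; simp

theorem inner_geomVec {T : ℕ} (w : EuclideanSpace ℝ (Fin T)) (r : ℝ) :
    inner ℝ w (geomVec T r) = ∑ u, w u * ((1 - r) * r ^ (u : ℕ)) := by
  simp [PiLp.inner_apply, mul_comm]

theorem continuous_inner_geomVec {T : ℕ} (w : EuclideanSpace ℝ (Fin T)) :
    Continuous fun r => inner ℝ w (geomVec T r) := by
  simp only [inner_geomVec]
  fun_prop

/-- With `n = i + j` in 1-based indices, both sides equal `2 / ((n - 1) n (n + 1))`. This makes the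
quadratic form of the Hankel matrix a mean square of `⟨w, geomVec T r⟩`. -/
theorem waveHankel_eq_integral (T : ℕ) (i j : Fin T) :
    waveHankel T i j = ∫ r in (0 : ℝ)..1, ((1 - r) * r ^ (i : ℕ)) * ((1 - r) * r ^ (j : ℕ)) := by
  have h : ∀ r : ℝ, ((1 - r) * r ^ (i : ℕ)) * ((1 - r) * r ^ (j : ℕ))
      = r ^ ((i : ℕ) + j) - 2 * r ^ ((i : ℕ) + j + 1) + r ^ ((i : ℕ) + j + 2) := by
    intro r; ring
  simp only [h]
  rw [intervalIntegral.integral_add (Continuous.intervalIntegrable (by fun_prop) _ _)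
      (Continuous.intervalIntegrable (by fun_prop) _ _),
    intervalIntegral.integral_sub (Continuous.intervalIntegrable (by fun_prop) _ _)
      (Continuous.intervalIntegrable (by fun_prop) _ _),
    intervalIntegral.integral_const_mul, integral_pow, integral_pow, integral_pow, waveHankel]
  push_cast
  have hi : (0 : ℝ) ≤ (i : ℕ) := Nat.cast_nonneg _
  have hj : (0 : ℝ) ≤ (j : ℕ) := Nat.cast_nonneg _
  generalize ((i : ℕ) : ℝ) = a at *
  generalize ((j : ℕ) : ℝ) = b at *
  have h1 : a + b + 1 ≠ 0 := by positivity
  have h2 : a + b + 1 + 1 ≠ 0 := by positivity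
  have h3 : a + b + 2 + 1 ≠ 0 := by positivity
  have h4 : (a + 1 + (b + 1)) ^ 3 - (a + 1 + (b + 1))
      = (a + b + 1) * (a + b + 1 + 1) * (a + b + 2 + 1) := by ring
  rw [h4]
  field_simp
  simp
  ring

theorem inner_waveHankel_eq_integral {T : ℕ} (w : EuclideanSpace ℝ (Fin T)) :
    inner ℝ w (Matrix.toEuclideanLin (waveHankel T) w)
      = ∫ r in (0 : ℝ)..1, (inner ℝ w (geomVec T r)) ^ 2 := by
  have h : ∀ r : ℝ, (inner ℝ w (geomVec T r)) ^ 2 = ∑ i, ∑ j, w i * w j *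
      (((1 - r) * r ^ (i : ℕ)) * ((1 - r) * r ^ (j : ℕ))) := by
    intro r
    rw [inner_geomVec, sq, sum_mul_sum]
    exact sum_congr rfl fun i _ => sum_congr rfl fun j _ => by ring
  simp only [h]
  rw [intervalIntegral.integral_finsetSum
    (fun i _ => Continuous.intervalIntegrable (by fun_prop) _ _)]
  simp only [PiLp.inner_apply, Matrix.toLpLin_apply, Matrix.mulVec, dotProduct]
  refine sum_congr rfl fun i _ => ?_
  rw [intervalIntegral.integral_finsetSum
    (fun j _ => Continuous.intervalIntegrable (by fun_prop) _ _)]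
  simp only [intervalIntegral.integral_const_mul, ← waveHankel_eq_integral]
  simp [sum_mul]
  exact sum_congr rfl fun j _ => by ring

theorem sum_geomVec_le_one {T : ℕ} {r : ℝ} (h0 : 0 ≤ r) :
    ∑ u : Fin T, (1 - r) * r ^ (u : ℕ) ≤ 1 := by
  rw [Fin.sum_univ_eq_sum_range (fun u => (1 - r) * r ^ u), ← mul_sum, mul_neg_geom_sum]
  have := pow_nonneg h0 T
  linarith

theorem norm_geomVec_sq_le {T : ℕ} {r : ℝ} (h0 : 0 ≤ r) (h1 : r ≤ 1) :
    ‖geomVec T r‖ ^ 2 ≤ 1 - r := by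
  rw [EuclideanSpace.norm_sq_eq]
  calc ∑ u : Fin T, ‖geomVec T r u‖ ^ 2
      ≤ ∑ u : Fin T, (1 - r) * ((1 - r) * r ^ (u : ℕ)) := by
        refine sum_le_sum fun u _ => ?_
        have := pow_le_one₀ h0 h1 (n := (u : ℕ))
        have h2 := pow_nonneg h0 (u : ℕ)
        rw [geomVec_apply, Real.norm_eq_abs, sq_abs, mul_pow, sq (1 - r), mul_assoc]
        gcongr
        nlinarith
    _ ≤ 1 - r := by
        rw [← mul_sum]
        exact mul_le_of_le_one_right (by linarith) (sum_geomVec_le_one h0)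

/-- The finite sum is dominated by the full geometric series, which sums to `2 (b - a)² / ((1 + a)
(1 + b) (1 - a b))`, and this denominator is at least `1 - a`. -/
theorem norm_geomVec_sub_sq_le {T : ℕ} {a b : ℝ} (ha : 0 ≤ a) (hab : a ≤ b) (hb : b < 1) :
    ‖geomVec T a - geomVec T b‖ ^ 2 * (1 - a) ≤ 2 * (b - a) ^ 2 := by
  have haa : a * a < 1 := by nlinarith
  have hbb : b * b < 1 := by nlinarith
  have hab' : a * b < 1 := by nlinarith
  have hs : HasSum (fun u : ℕ => ((1 - a) * a ^ u - (1 - b) * b ^ u) ^ 2)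
      ((1 - a) ^ 2 * (1 - a * a)⁻¹ + (1 - b) ^ 2 * (1 - b * b)⁻¹
        - 2 * (1 - a) * (1 - b) * (1 - a * b)⁻¹) := by
    have h := (((hasSum_geometric_of_lt_one (by nlinarith) haa).mul_left ((1 - a) ^ 2)).add
      ((hasSum_geometric_of_lt_one (by nlinarith) hbb).mul_left ((1 - b) ^ 2))).sub
      ((hasSum_geometric_of_lt_one (by nlinarith) hab').mul_left (2 * (1 - a) * (1 - b)))
    refine h.congr_fun fun u => ?_
    simp only [mul_pow]; ring
  have hle : ‖geomVec T a - geomVec T b‖ ^ 2 ≤ (1 - a) ^ 2 * (1 - a * a)⁻¹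
      + (1 - b) ^ 2 * (1 - b * b)⁻¹ - 2 * (1 - a) * (1 - b) * (1 - a * b)⁻¹ := by
    rw [EuclideanSpace.norm_sq_eq]
    simp only [PiLp.sub_apply, geomVec_apply, Real.norm_eq_abs, sq_abs]
    rw [Fin.sum_univ_eq_sum_range (fun u => ((1 - a) * a ^ u - (1 - b) * b ^ u) ^ 2)]
    exact sum_le_hasSum _ (fun u _ => sq_nonneg _) hs
  have hid : (1 - a) ^ 2 * (1 - a * a)⁻¹ + (1 - b) ^ 2 * (1 - b * b)⁻¹
        - 2 * (1 - a) * (1 - b) * (1 - a * b)⁻¹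
      = 2 * (b - a) ^ 2 / ((1 + a) * (1 + b) * (1 - a * b)) := by
    have h1 : 1 - a ≠ 0 := by linarith
    have h2 : 1 - b ≠ 0 := by linarith
    have h3 : 1 + a ≠ 0 := by linarith
    have h4 : 1 + b ≠ 0 := by linarith
    have h5 : 1 - a * b ≠ 0 := by linarith
    rw [show 1 - a * a = (1 - a) * (1 + a) by ring, show 1 - b * b = (1 - b) * (1 + b) by ring]
    field_simp
    ring
  rw [hid] at hle
  have hden : 1 - a ≤ (1 + a) * (1 + b) * (1 - a * b) := by
    have h1 : 1 - a ≤ 1 - a * b := by nlinarith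
    have h2 : (1 : ℝ) ≤ (1 + a) * (1 + b) := by nlinarith
    nlinarith
  have hpos : 0 < 1 - a := by linarith
  calc ‖geomVec T a - geomVec T b‖ ^ 2 * (1 - a)
      ≤ 2 * (b - a) ^ 2 / ((1 + a) * (1 + b) * (1 - a * b)) * (1 - a) := by gcongr
    _ ≤ 2 * (b - a) ^ 2 / (1 - a) * (1 - a) := by gcongr
    _ = 2 * (b - a) ^ 2 := by field_simp

/-- Factor the difference of squares: the difference vector may lose a factor `(1 - a)^(-1/2)`, but
the sum vector has norm at most `2 (1 - a)^(1/2)`, so the singularity at `1` cancels. The product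
gives `√8 ≤ 3`. -/
theorem abs_inner_geomVec_sq_sub_le {T : ℕ} {w : EuclideanSpace ℝ (Fin T)} (hw : ‖w‖ ≤ 1)
    {a b : ℝ} (ha : 0 ≤ a) (hab : a ≤ b) (hb : b < 1) :
    |(inner ℝ w (geomVec T a)) ^ 2 - (inner ℝ w (geomVec T b)) ^ 2| ≤ 3 * (b - a) := by
  have hpos : 0 < 1 - a := by linarith
  have hfac : (inner ℝ w (geomVec T a)) ^ 2 - (inner ℝ w (geomVec T b)) ^ 2
      = inner ℝ w (geomVec T a - geomVec T b) * inner ℝ w (geomVec T a + geomVec T b) := by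
    rw [inner_sub_right, inner_add_right]; ring
  have hcs : ∀ v : EuclideanSpace ℝ (Fin T), |inner ℝ w v| ≤ ‖v‖ := fun v =>
    (abs_real_inner_le_norm w v).trans (mul_le_of_le_one_left (norm_nonneg _) hw)
  have h1 := norm_geomVec_sub_sq_le (T := T) ha hab hb
  have h2 : ‖geomVec T a + geomVec T b‖ ^ 2 ≤ 4 * (1 - a) := by
    have e1 := norm_geomVec_sq_le (T := T) ha (hab.trans hb.le)
    have e2 := norm_geomVec_sq_le (T := T) (ha.trans hab) hb.le
    have e3 := norm_add_le (geomVec T a) (geomVec T b)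
    have e4 := norm_nonneg (geomVec T a + geomVec T b)
    nlinarith [sq_nonneg (‖geomVec T a‖ - ‖geomVec T b‖)]
  rw [hfac, abs_mul]
  have h3 : (‖geomVec T a - geomVec T b‖ * ‖geomVec T a + geomVec T b‖) ^ 2
      ≤ (3 * (b - a)) ^ 2 := by
    rw [mul_pow]
    calc ‖geomVec T a - geomVec T b‖ ^ 2 * ‖geomVec T a + geomVec T b‖ ^ 2
        ≤ ‖geomVec T a - geomVec T b‖ ^ 2 * (4 * (1 - a)) := by gcongr
      _ ≤ (3 * (b - a)) ^ 2 := by nlinarith [sq_nonneg (b - a)]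
  exact (mul_le_mul (hcs _) (hcs _) (abs_nonneg _) (norm_nonneg _)).trans
    (abs_le_of_sq_le_sq' h3 (by linarith)).2

/-- A nonnegative `3`-Lipschitz function on `[0, 1)` bounded by `1` is controlled by its integral. -/
theorem sq_le_integral_of_lipschitz {f : ℝ → ℝ} (hf : Continuous f) (h0 : ∀ r, 0 ≤ f r)
    (hlip : ∀ a b, 0 ≤ a → a ≤ b → b < 1 → |f a - f b| ≤ 3 * (b - a)) {s : ℝ} (hs0 : 0 ≤ s)
    (hs1 : s < 1) (hfs : f s ≤ 1) : f s ^ 2 ≤ 12 * ∫ r in (0 : ℝ)..1, f r := by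
  have key : ∀ a b, 0 ≤ a → a ≤ b → b < 1 → b - a = f s / 6 → (∀ r ∈ Set.Icc a b, f s / 2 ≤ f r) →
      f s ^ 2 ≤ 12 * ∫ r in (0 : ℝ)..1, f r := by
    intro a b ha hab hb hlen hr
    have h1 : ∫ r in a..b, f s / 2 ≤ ∫ r in a..b, f r :=
      intervalIntegral.integral_mono_on hab (by simp) (hf.intervalIntegrable _ _) hr
    have h2 : ∫ r in a..b, f r ≤ ∫ r in (0 : ℝ)..1, f r :=
      intervalIntegral.integral_mono_interval ha hab hb.le
        (Filter.Eventually.of_forall fun r => h0 r) (hf.intervalIntegrable _ _)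
    rw [intervalIntegral.integral_const, hlen, smul_eq_mul] at h1
    nlinarith
  have hs := h0 s
  -- On an interval of length `f s / 6 ≤ 1 / 6` ending at `s`, `f` stays above `f s / 2`. It is
  -- placed to the right or left of `s` so as to remain inside `[0, 1)`.
  rcases le_total s (1 / 2) with h | h
  · refine key s (s + f s / 6) hs0 (by linarith) (by linarith) (by ring) fun r hr => ?_
    have := (abs_le.1 (hlip s r hs0 hr.1 (by linarith [hr.2]))).2
    linarith [hr.2]
  · refine key (s - f s / 6) s (by linarith) (by linarith) hs1 (by ring) fun r hr => ?_
    have := (abs_le.1 (hlip r s (by linarith [hr.1]) hr.2 hs1)).1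
    linarith [hr.1]

theorem inner_geomVec_pow_four_le {T : ℕ} {w : EuclideanSpace ℝ (Fin T)} (hw : ‖w‖ ≤ 1)
    {r : ℝ} (h0 : 0 ≤ r) (h1 : r ≤ 1) :
    (inner ℝ w (geomVec T r)) ^ 4
      ≤ 12 * inner ℝ w (Matrix.toEuclideanLin (waveHankel T) w) := by
  rw [inner_waveHankel_eq_integral]
  rcases h1.eq_or_lt with rfl | h1
  · rw [geomVec_one, inner_zero_right]
    have : 0 ≤ ∫ r in (0 : ℝ)..1, (inner ℝ w (geomVec T r)) ^ 2 :=
      intervalIntegral.integral_nonneg zero_le_one fun r _ => sq_nonneg _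
    simpa using this
  · have h := sq_le_integral_of_lipschitz (f := fun r => (inner ℝ w (geomVec T r)) ^ 2)
      ((continuous_inner_geomVec w).pow 2) (fun r => sq_nonneg _)
      (fun a b ha hab hb => abs_inner_geomVec_sq_sub_le hw ha hab hb) h0 h1 ?_
    · simpa [← pow_mul] using h
    · have h2 := norm_geomVec_sq_le (T := T) h0 h1.le
      have h3 := abs_real_inner_le_norm w (geomVec T r)
      have h4 : |inner ℝ w (geomVec T r)| ≤ 1 := by
        have : ‖geomVec T r‖ ≤ 1 := by nlinarith [norm_nonneg (geomVec T r)]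
        exact h3.trans (mul_le_one₀ hw (norm_nonneg _) this)
      exact (sq_le_one_iff_abs_le_one _).2 h4

theorem IsWaveFilters.inner_eigen {T : ℕ} {σ : Fin T → ℝ} {φ : Fin T → EuclideanSpace ℝ (Fin T)}
    (h : IsWaveFilters T σ φ) (i : Fin T) :
    inner ℝ (φ i) (Matrix.toEuclideanLin (waveHankel T) (φ i)) = σ i := by
  rw [h.eigen, inner_smul_right, real_inner_self_eq_norm_sq, h.orthonormal.norm_eq_one]
  simp

theorem IsWaveFilters.nonneg {T : ℕ} {σ : Fin T → ℝ} {φ : Fin T → EuclideanSpace ℝ (Fin T)}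
    (h : IsWaveFilters T σ φ) (i : Fin T) : 0 ≤ σ i := by
  rw [← h.inner_eigen, inner_waveHankel_eq_integral]
  exact intervalIntegral.integral_nonneg zero_le_one fun r _ => sq_nonneg _

theorem IsWaveFilters.inner_geomVec_pow_four_le {T : ℕ} {σ : Fin T → ℝ}
    {φ : Fin T → EuclideanSpace ℝ (Fin T)} (h : IsWaveFilters T σ φ) (i : Fin T) {r : ℝ}
    (h0 : 0 ≤ r) (h1 : r ≤ 1) : (inner ℝ (φ i) (geomVec T r)) ^ 4 ≤ 12 * σ i := by
  rw [← h.inner_eigen i]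
  exact _root_.inner_geomVec_pow_four_le (h.orthonormal.norm_eq_one i).le h0 h1

/-- Uses `12 ≤ 2 ^ 4`. The weight `σ_h^{1/4}` in the prediction is thus the natural size of the
coefficients, and dividing by it leaves parameters bounded by `2`. -/
theorem IsWaveFilters.abs_inner_geomVec_le {T : ℕ} {σ : Fin T → ℝ}
    {φ : Fin T → EuclideanSpace ℝ (Fin T)} (h : IsWaveFilters T σ φ) (i : Fin T) {r : ℝ}
    (h0 : 0 ≤ r) (h1 : r ≤ 1) :
    |inner ℝ (φ i) (geomVec T r)| ≤ 2 * σ i ^ (1 / 4 : ℝ) := by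
  have hσ := h.nonneg i
  refine le_of_pow_le_pow_left₀ (n := 4) (by norm_num) (by positivity) ?_
  rw [mul_pow, ← Real.rpow_natCast (σ i ^ (1 / 4 : ℝ)), ← Real.rpow_mul hσ]
  have := h.inner_geomVec_pow_four_le i h0 h1
  rw [← (show Even 4 by decide).pow_abs] at this
  norm_num
  linarith

/-! ### Exponential decay of the eigenvalues. -/

/-- In the binomial expansion around `c`, each term with `j ≥ q` is at most `3 ^ (-q)` times the
same term with `|r - c|` tripled; these sum to at most `(c + 3 |r - c|) ^ u`. -/
theorem abs_pow_sub_taylor_le {c : ℝ} (hc : 0 ≤ c) (r : ℝ) (q u : ℕ) :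
    |r ^ u - ∑ j ∈ range q, (r - c) ^ j * (c ^ (u - j) * (u.choose j))|
      ≤ (1 / 3) ^ q * (c + 3 * |r - c|) ^ u := by
  have expand : ∀ z : ℝ, (z + c) ^ u
      = ∑ j ∈ range (q + (u + 1)), z ^ j * (c ^ (u - j) * (u.choose j)) := by
    intro z
    rw [add_pow]
    have hsub : range (u + 1) ⊆ range (q + (u + 1)) := range_mono (by omega)
    rw [← sum_subset hsub fun j _ hj => by
      rw [Nat.choose_eq_zero_of_lt (by simpa using hj)]; simp]
    exact sum_congr rfl fun j _ => by ring
  have h1 : r ^ u = ∑ j ∈ range (q + (u + 1)), (r - c) ^ j * (c ^ (u - j) * (u.choose j)) := by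
    rw [← expand, sub_add_cancel]
  rw [h1, sum_range_add _ q (u + 1), add_sub_cancel_left, add_comm c, expand, mul_sum,
    sum_range_add _ q (u + 1)]
  refine (abs_sum_le_sum_abs _ _).trans (le_add_of_nonneg_of_le
    (sum_nonneg fun j _ => by positivity) (sum_le_sum fun j _ => ?_))
  have hw : (0 : ℝ) ≤ c ^ (u - (q + j)) * (u.choose (q + j)) := by positivity
  rw [abs_mul, abs_pow, abs_of_nonneg hw, ← mul_assoc ((1 / 3 : ℝ) ^ q)]
  refine mul_le_mul_of_nonneg_right ?_ hw
  rw [mul_pow, ← mul_assoc]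
  refine le_mul_of_one_le_left (by positivity) ?_
  rw [pow_add, ← mul_assoc, ← mul_pow]
  norm_num
  exact one_le_pow₀ (by norm_num)

/-- Expansion points: the midpoints of the dyadic intervals `[1 - 2⁻ⁱ, 1 - 2⁻ⁱ⁻¹]`, and the
point `1`. -/
def dyadicCenter (L i : ℕ) : ℝ := if i < L then 1 - 3 / 2 * (1 / 2) ^ (i + 1) else 1

theorem dyadicCenter_nonneg (L i : ℕ) : 0 ≤ dyadicCenter L i := by
  unfold dyadicCenter
  split_ifs
  · have : ((1 : ℝ) / 2) ^ (i + 1) ≤ 1 / 2 := by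
      rw [pow_succ]
      exact mul_le_of_le_one_left (by norm_num) (pow_le_one₀ (by norm_num) (by norm_num))
    linarith
  · exact zero_le_one

/-- A dyadic interval has its midpoint three half-lengths away from `1`, so there `c + 3 |r - c| ≤
1`. Only the last interval, of length `(1 / 2) ^ L` and expanded at `1`, costs the excess. -/
theorem exists_dyadicCenter (L : ℕ) {r : ℝ} (h0 : 0 ≤ r) (h1 : r ≤ 1) :
    ∃ i, i < L + 1 ∧ dyadicCenter L i + 3 * |r - dyadicCenter L i| ≤ 1 + 3 * (1 / 2) ^ L := by
  rcases le_or_gt (1 - r) ((1 / 2) ^ L) with h | h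
  · refine ⟨L, by omega, ?_⟩
    rw [dyadicCenter, if_neg (lt_irrefl L), abs_of_nonpos (by linarith)]
    linarith
  · have hex : ∃ i, ((1 : ℝ) / 2) ^ i < 1 - r := ⟨L, h⟩
    classical
    obtain ⟨i, hi⟩ : ∃ i, Nat.find hex = i + 1 := by
      refine Nat.exists_eq_succ_of_ne_zero fun h => ?_
      have := Nat.find_spec hex
      rw [h] at this
      norm_num at this
      linarith
    have hs := Nat.find_spec hex
    have hm := Nat.find_min hex (m := i) (by omega)
    have hL : i < L := by have := Nat.find_min' hex h; omega
    rw [hi] at hs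
    refine ⟨i, by omega, ?_⟩
    have habs : |r - (1 - 3 / 2 * (1 / 2) ^ (i + 1))| ≤ 1 / 2 * (1 / 2) ^ (i + 1) := by
      rw [abs_le]
      rw [pow_succ] at hs ⊢
      constructor <;> linarith
    rw [dyadicCenter, if_pos hL]
    have : (0 : ℝ) ≤ (1 / 2) ^ L := by positivity
    linarith

/-- The span of these vectors, over the centers `c` and `j < q`, approximates every `geomVec`. -/
def taylorVec (T : ℕ) (c : ℝ) (j : ℕ) : EuclideanSpace ℝ (Fin T) :=
  WithLp.toLp 2 fun u => c ^ ((u : ℕ) - j) * ((u : ℕ).choose j)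

theorem norm_geomVec_sub_taylor_sq_le {T L : ℕ} (hT : T ≤ 2 ^ L) (q : ℕ) {r c : ℝ} (h0 : 0 ≤ r)
    (h1 : r ≤ 1) (hc : 0 ≤ c) (hrc : c + 3 * |r - c| ≤ 1 + 3 * (1 / 2) ^ L) :
    ‖geomVec T r - ∑ j ∈ range q, ((1 - r) * (r - c) ^ j) • taylorVec T c j‖ ^ 2
      ≤ T * (441 * (1 / 9) ^ q) := by
  rw [EuclideanSpace.norm_sq_eq]
  calc _ ≤ ∑ u : Fin T, (441 * (1 / 9) ^ q : ℝ) := sum_le_sum fun u _ => ?_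
    _ = _ := by simp
  have e1 : (geomVec T r - ∑ j ∈ range q, ((1 - r) * (r - c) ^ j) • taylorVec T c j) u
      = (1 - r) * (r ^ (u : ℕ)
        - ∑ j ∈ range q, (r - c) ^ j * (c ^ ((u : ℕ) - j) * ((u : ℕ).choose j))) := by
    simp [taylorVec, mul_sub, mul_sum, mul_assoc]
  -- Since `T ≤ 2 ^ L`, the excess compounds to at most `exp 3 ≤ 21`; its square is the constant
  -- `441`.
  have e2 : (c + 3 * |r - c|) ^ (u : ℕ) ≤ 21 := by
    have hT0 : (T : ℝ) ≤ 2 ^ L := by exact_mod_cast hT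
    calc (c + 3 * |r - c|) ^ (u : ℕ) ≤ (1 + 3 * (1 / 2) ^ L) ^ (u : ℕ) := by gcongr
      _ ≤ (1 + 3 * (1 / 2) ^ L) ^ T := by
        refine pow_le_pow_right₀ ?_ u.2.le
        have : (0 : ℝ) ≤ (1 / 2) ^ L := by positivity
        linarith
      _ ≤ (Real.exp (3 * (1 / 2) ^ L)) ^ T := by
        gcongr
        rw [add_comm]; exact Real.add_one_le_exp _
      _ = Real.exp (T * (3 * (1 / 2) ^ L)) := by rw [← Real.exp_nat_mul]
      _ ≤ Real.exp 3 := by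
        gcongr
        calc (T : ℝ) * (3 * (1 / 2) ^ L) ≤ 2 ^ L * (3 * (1 / 2) ^ L) := by gcongr
          _ = 3 * (2 * (1 / 2)) ^ L := by rw [mul_pow]; ring
          _ = 3 := by norm_num
      _ = Real.exp 1 ^ 3 := by rw [← Real.exp_nat_mul]; norm_num
      _ ≤ 2.7182818286 ^ 3 := by gcongr; exact Real.exp_one_lt_d9.le
      _ ≤ 21 := by norm_num
  have e3 := abs_pow_sub_taylor_le hc r q u
  have e4 : |(geomVec T r - ∑ j ∈ range q, ((1 - r) * (r - c) ^ j) • taylorVec T c j) u|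
      ≤ (1 / 3) ^ q * 21 := by
    rw [e1, abs_mul, abs_of_nonneg (by linarith : 0 ≤ 1 - r)]
    calc _ ≤ 1 * ((1 / 3) ^ q * (c + 3 * |r - c|) ^ (u : ℕ)) := by gcongr; linarith
      _ ≤ (1 / 3) ^ q * 21 := by rw [one_mul]; gcongr
  rw [Real.norm_eq_abs]
  calc _ ≤ ((1 / 3) ^ q * 21 : ℝ) ^ 2 := by gcongr
    _ = 441 * (1 / 9) ^ q := by
      rw [mul_pow, ← pow_mul, mul_comm q 2, pow_mul]; norm_num; ring

/-- One half of Courant–Fischer: the span of the first `i + 1` eigenvectors contains a nonzero `w`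
orthogonal to all `v j`. Its Rayleigh quotient is at least `σ i`, and at most `δ` because `w` sees
only the approximation error of `geomVec T r`. -/
theorem IsWaveFilters.eigenvalue_le_of_approx {T : ℕ} {σ : Fin T → ℝ}
    {φ : Fin T → EuclideanSpace ℝ (Fin T)} (h : IsWaveFilters T σ φ) {J : Type*} [Fintype J]
    (v : J → EuclideanSpace ℝ (Fin T)) {δ : ℝ}
    (hv : ∀ r ∈ Set.Icc (0 : ℝ) 1, ∃ a : J → ℝ, ‖geomVec T r - ∑ j, a j • v j‖ ^ 2 ≤ δ)
    (i : Fin T) (hi : Fintype.card J ≤ i) : σ i ≤ δ := by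
  have hle : (i : ℕ) + 1 ≤ T := i.2
  let ψ : Fin ((i : ℕ) + 1) → EuclideanSpace ℝ (Fin T) := fun a => φ (Fin.castLE hle a)
  have hψ : Orthonormal ℝ ψ := h.orthonormal.comp _ (Fin.castLE_injective hle)
  let f : (Fin ((i : ℕ) + 1) → ℝ) →ₗ[ℝ] (J → ℝ) :=
    LinearMap.pi fun j => ∑ a, (inner ℝ (v j) (ψ a)) • LinearMap.proj a
  obtain ⟨a, ha, ha0⟩ := Submodule.exists_mem_ne_zero_of_ne_bot
    (LinearMap.ker_ne_bot_of_finrank_lt (f := f) (by simp; omega))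
  set w : EuclideanSpace ℝ (Fin T) := ∑ b, a b • ψ b with hw
  have hvw : ∀ j, inner ℝ w (v j) = 0 := by
    intro j
    have := congrFun (LinearMap.mem_ker.1 ha) j
    simp only [f, LinearMap.pi_apply, LinearMap.sum_apply, LinearMap.smul_apply,
      LinearMap.proj_apply, smul_eq_mul, Pi.zero_apply] at this
    rw [real_inner_comm, hw, inner_sum, ← this]
    exact sum_congr rfl fun b _ => by rw [inner_smul_right, mul_comm]
  have hnorm : ‖w‖ ^ 2 = ∑ b, a b ^ 2 := by
    rw [← real_inner_self_eq_norm_sq, hw, hψ.inner_sum]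
    simp [sq]
  have hpos : 0 < ‖w‖ ^ 2 := by
    rw [hnorm]
    obtain ⟨b, hb⟩ := Function.ne_iff.1 ha0
    exact sum_pos' (fun _ _ => sq_nonneg _) ⟨b, mem_univ b, by have : a b ≠ 0 := hb; positivity⟩
  have hZ : inner ℝ w (Matrix.toEuclideanLin (waveHankel T) w)
      = ∑ b, a b ^ 2 * σ (Fin.castLE hle b) := by
    have : Matrix.toEuclideanLin (waveHankel T) w
        = ∑ b, (a b * σ (Fin.castLE hle b)) • ψ b := by
      rw [hw, map_sum]
      refine sum_congr rfl fun b _ => ?_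
      rw [map_smul, h.eigen, smul_smul]
    rw [this, hw, hψ.inner_sum]
    exact sum_congr rfl fun b _ => by simp; ring
  have hlow : σ i * ‖w‖ ^ 2 ≤ inner ℝ w (Matrix.toEuclideanLin (waveHankel T) w) := by
    rw [hZ, hnorm, mul_sum]
    refine sum_le_sum fun b _ => ?_
    rw [mul_comm]
    have : σ i ≤ σ (Fin.castLE hle b) :=
      h.antitone (Fin.le_def.2 (by simpa using Nat.lt_succ_iff.1 b.2))
    gcongr
  have hup : inner ℝ w (Matrix.toEuclideanLin (waveHankel T) w) ≤ δ * ‖w‖ ^ 2 := by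
    rw [inner_waveHankel_eq_integral]
    calc _ ≤ ∫ r in (0 : ℝ)..1, δ * ‖w‖ ^ 2 := by
          refine intervalIntegral.integral_mono_on zero_le_one
            (((continuous_inner_geomVec w).pow 2).intervalIntegrable _ _) (by simp)
            fun r hr => ?_
          obtain ⟨b, hb⟩ := hv r hr
          have : inner ℝ w (geomVec T r) = inner ℝ w (geomVec T r - ∑ j, b j • v j) := by
            rw [inner_sub_right, inner_sum]
            simp [inner_smul_right, hvw]
          rw [this, ← sq_abs]
          calc _ ≤ (‖w‖ * ‖geomVec T r - ∑ j, b j • v j‖) ^ 2 := by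
                gcongr; exact abs_real_inner_le_norm _ _
            _ ≤ δ * ‖w‖ ^ 2 := by rw [mul_pow, mul_comm]; gcongr
      _ = _ := by simp
  exact le_of_mul_le_mul_right (hlow.trans hup) hpos

theorem IsWaveFilters.eigenvalue_le {T : ℕ} {σ : Fin T → ℝ}
    {φ : Fin T → EuclideanSpace ℝ (Fin T)} (h : IsWaveFilters T σ φ) {L : ℕ} (hT : T ≤ 2 ^ L)
    (q : ℕ) (i : Fin T) (hi : q * (L + 1) ≤ i) : σ i ≤ T * (441 * (1 / 9) ^ q) := by
  refine h.eigenvalue_le_of_approx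
    (fun j : Fin (L + 1) × Fin q => taylorVec T (dyadicCenter L j.1) j.2) ?_ i
    (by simpa [mul_comm] using hi)
  rintro r ⟨h0, h1⟩
  obtain ⟨b, hb, hrb⟩ := exists_dyadicCenter L h0 h1
  refine ⟨fun j => if j.1 = ⟨b, hb⟩ then (1 - r) * (r - dyadicCenter L b) ^ (j.2 : ℕ) else 0, ?_⟩
  convert norm_geomVec_sub_taylor_sq_le hT q h0 h1 (dyadicCenter_nonneg L b) hrb using 4
  rw [Fintype.sum_prod_type, sum_eq_single (⟨b, hb⟩ : Fin (L + 1))]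
  · simp only [if_true]
    exact Fin.sum_univ_eq_sum_range (fun j => ((1 - r) * (r - dyadicCenter L b) ^ j) •
      taylorVec T (dyadicCenter L b) j) q
  · intro j _ hj
    simp [hj]
  · simp

/-! ### Truncation to the leading filters. -/

/-- The orthogonal projection of `geomVec T r` on the span of the first `k` filters. -/
def filterProj {T k : ℕ} (hk : k ≤ T) (φ : Fin T → EuclideanSpace ℝ (Fin T)) (r : ℝ) :
    EuclideanSpace ℝ (Fin T) :=
  ∑ h : Fin k, (inner ℝ (φ (Fin.castLE hk h)) (geomVec T r)) • φ (Fin.castLE hk h)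

theorem IsWaveFilters.norm_geomVec_sub_filterProj_sq {T k : ℕ} {σ : Fin T → ℝ}
    {φ : Fin T → EuclideanSpace ℝ (Fin T)} (h : IsWaveFilters T σ φ) (hk : k ≤ T) (r : ℝ) :
    ‖geomVec T r - filterProj hk φ r‖ ^ 2
      = ∑ i : Fin T, if (i : ℕ) < k then 0 else (inner ℝ (φ i) (geomVec T r)) ^ 2 := by
  -- The `T` orthonormal filters already form a basis; extending from all indices only repackages
  -- them, so that Parseval applies.
  obtain ⟨b, hb'⟩ := Orthonormal.exists_orthonormalBasis_extension_of_card_eq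
    (ι := Fin T) (v := φ) (s := Set.univ) (by simp) (h.orthonormal.comp _ Subtype.val_injective)
  have hb : ∀ i, b i = φ i := fun i => hb' i (Set.mem_univ i)
  rw [← b.sum_sq_norm_inner_right]
  refine sum_congr rfl fun i _ => ?_
  rw [hb, inner_sub_right, filterProj, inner_sum]
  simp only [inner_smul_right, orthonormal_iff_ite.1 h.orthonormal]
  split_ifs with hi
  · rw [sum_eq_single (⟨i, hi⟩ : Fin k)]
    · simp
    · intro j _ hj
      rw [if_neg, mul_zero]
      rintro rfl
      exact hj rfl
    · simp
  · rw [sum_eq_zero]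
    · simp
    · intro j _
      rw [if_neg, mul_zero]
      rintro rfl
      exact hi j.2

/-- Cauchy–Schwarz passes from `ℓ¹` to `ℓ²` with a factor `T`, and each of the at most `T` omitted
squared coefficients is at most `√(12 δ)`. -/
theorem IsWaveFilters.sum_abs_geomVec_sub_filterProj_pow_four_le {T k : ℕ} {σ : Fin T → ℝ}
    {φ : Fin T → EuclideanSpace ℝ (Fin T)} (h : IsWaveFilters T σ φ) (hk : k ≤ T) {δ r : ℝ}
    (hδ0 : 0 ≤ δ) (hδ : ∀ i : Fin T, k ≤ i → σ i ≤ δ) (h0 : 0 ≤ r) (h1 : r ≤ 1) :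
    (∑ u, |geomVec T r u - filterProj hk φ r u|) ^ 4 ≤ 12 * T ^ 4 * δ := by
  have hcs : (∑ u, |geomVec T r u - filterProj hk φ r u|) ^ 2
      ≤ T * ‖geomVec T r - filterProj hk φ r‖ ^ 2 := by
    refine sq_sum_le_card_mul_sum_sq.trans ?_
    rw [EuclideanSpace.norm_sq_eq]
    simp
  have hn : ‖geomVec T r - filterProj hk φ r‖ ^ 2 ≤ T * √(12 * δ) := by
    rw [h.norm_geomVec_sub_filterProj_sq]
    calc _ ≤ ∑ i : Fin T, √(12 * δ) := sum_le_sum fun i _ => ?_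
      _ = _ := by simp
    split_ifs with hi
    · positivity
    · refine Real.le_sqrt_of_sq_le ?_
      rw [← pow_mul]
      have := hδ i (not_lt.1 hi)
      have h4 := h.inner_geomVec_pow_four_le i h0 h1
      norm_num
      linarith
  calc (∑ u, |geomVec T r u - filterProj hk φ r u|) ^ 4
      = ((∑ u, |geomVec T r u - filterProj hk φ r u|) ^ 2) ^ 2 := by rw [← pow_mul]
    _ ≤ (T * (T * √(12 * δ))) ^ 2 := by
      gcongr
      exact hcs.trans (by gcongr)
    _ = 12 * T ^ 4 * δ := by
      rw [mul_pow, mul_pow, Real.sq_sqrt (by positivity)]; ring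

/-! ### Discretization of the phases. -/

/-- Round the angle down to a multiple of `2π / W`; the chord is no longer than the arc. -/
theorem Complex.exists_rootOfUnity_near {W : ℕ} (hW : 0 < W) {z : ℂ} (hz : ‖z‖ = 1) :
    ∃ p : Fin W, ‖z - Complex.exp ((2 * Real.pi * (p : ℕ) / W : ℝ) * Complex.I)‖
      ≤ 2 * Real.pi / W := by
  have hWr : (0 : ℝ) < W := by exact_mod_cast hW
  obtain ⟨θ, hθ, rfl⟩ : ∃ θ ∈ Set.Ico (0 : ℝ) (2 * Real.pi), Complex.exp (θ * Complex.I) = z := by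
    have h := toIcoMod_mem_Ico Real.two_pi_pos 0 (Complex.arg z)
    rw [zero_add] at h
    refine ⟨_, h, ?_⟩
    conv_rhs => rw [← Complex.norm_mul_exp_arg_mul_I z, hz]
    rw [Complex.ofReal_one, one_mul, toIcoMod, Complex.exp_eq_exp_iff_exists_int]
    exact ⟨-toIcoDiv Real.two_pi_pos 0 (Complex.arg z), by push_cast; simp; ring⟩
  set s : ℝ := θ * W / (2 * Real.pi) with hs
  have hpi := Real.two_pi_pos
  have hs0 : 0 ≤ s := by have := hθ.1; positivity
  have hsW : s < W := by
    rw [hs, div_lt_iff₀ hpi, mul_comm]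
    exact mul_lt_mul_of_pos_left hθ.2 hWr
  have hfl : ⌊s⌋₊ < W := (Nat.floor_lt hs0).2 hsW
  refine ⟨⟨⌊s⌋₊, hfl⟩, ?_⟩
  have hθs : θ = 2 * Real.pi * s / W := by rw [hs]; field_simp
  have hd : |θ - 2 * Real.pi * ⌊s⌋₊ / W| ≤ 2 * Real.pi / W := by
    rw [hθs, ← sub_div, ← mul_sub, abs_of_nonneg]
    · have := Nat.lt_floor_add_one s
      exact div_le_div_of_nonneg_right (mul_le_of_le_one_right hpi.le (by linarith)) hWr.le
    · have := Nat.floor_le hs0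
      have : 0 ≤ s - ⌊s⌋₊ := by linarith
      positivity
  refine le_trans ?_ hd
  simp only
  have e : Complex.exp (θ * Complex.I) - Complex.exp ((2 * Real.pi * ⌊s⌋₊ / W : ℝ) * Complex.I)
      = Complex.exp ((2 * Real.pi * ⌊s⌋₊ / W : ℝ) * Complex.I)
        * (Complex.exp (Complex.I * (θ - 2 * Real.pi * ⌊s⌋₊ / W : ℝ)) - 1) := by
    rw [mul_sub, mul_one, ← Complex.exp_add]
    congr 2
    push_cast; ring
  rw [e, norm_mul, Complex.norm_exp_ofReal_mul_I, one_mul]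
  exact Real.norm_exp_I_mul_ofReal_sub_one_le

theorem norm_pow_sub_pow_le_of_norm_le_one {z w : ℂ} (hz : ‖z‖ ≤ 1) (hw : ‖w‖ ≤ 1) (n : ℕ) :
    ‖z ^ n - w ^ n‖ ≤ n * ‖z - w‖ := by
  rw [← Commute.geom_sum₂_mul (Commute.all z w), norm_mul]
  gcongr
  refine (norm_sum_le_of_le (n := fun _ => (1 : ℝ)) _ fun i _ => ?_).trans_eq (by simp)
  rw [norm_mul, norm_pow, norm_pow]
  exact mul_le_one₀ (pow_le_one₀ (norm_nonneg _) hz) (by positivity) (pow_le_one₀ (norm_nonneg _) hw)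

/-! ### Frobenius and operator norms. -/

section FrobeniusNorm

variable {𝕜 : Type*} [RCLike 𝕜] {a b : ℕ}

theorem frobNorm_nonneg (X : Matrix (Fin a) (Fin b) 𝕜) : 0 ≤ frobNorm X := Real.sqrt_nonneg _

attribute [local instance] Matrix.frobeniusNormedAddCommGroup Matrix.frobeniusNormedSpace in
theorem frobNorm_eq_norm (X : Matrix (Fin a) (Fin b) 𝕜) : frobNorm X = ‖X‖ := by
  rw [frobNorm, Matrix.frobenius_norm_def, Real.sqrt_eq_rpow]
  simp

attribute [local instance] Matrix.frobeniusNormedAddCommGroup Matrix.frobeniusNormedSpace in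
theorem frobNorm_sum_le {ι : Type*} (s : Finset ι) (X : ι → Matrix (Fin a) (Fin b) 𝕜) :
    frobNorm (∑ i ∈ s, X i) ≤ ∑ i ∈ s, frobNorm (X i) := by
  simp only [frobNorm_eq_norm]
  exact norm_sum_le _ _

attribute [local instance] Matrix.frobeniusNormedAddCommGroup Matrix.frobeniusNormedSpace in
theorem frobNorm_smul (c : 𝕜) (X : Matrix (Fin a) (Fin b) 𝕜) :
    frobNorm (c • X) = ‖c‖ * frobNorm X := by
  simp only [frobNorm_eq_norm]
  exact norm_smul _ _

theorem frobNorm_zero : frobNorm (0 : Matrix (Fin a) (Fin b) 𝕜) = 0 := by simp [frobNorm]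

theorem frobNorm_neg (X : Matrix (Fin a) (Fin b) 𝕜) : frobNorm (-X) = frobNorm X := by
  simp [frobNorm]

theorem frobNorm_le_of_norm_le {𝕜' : Type*} [RCLike 𝕜'] {X : Matrix (Fin a) (Fin b) 𝕜}
    {Y : Matrix (Fin a) (Fin b) 𝕜'} (h : ∀ i j, ‖X i j‖ ≤ ‖Y i j‖) : frobNorm X ≤ frobNorm Y := by
  unfold frobNorm
  gcongr with i _ j _
  exact h i j

theorem frobNorm_map_re_le (X : Matrix (Fin a) (Fin b) ℂ) :
    frobNorm (X.map Complex.re) ≤ frobNorm X :=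
  frobNorm_le_of_norm_le fun i j => Complex.abs_re_le_norm (X i j)

theorem frobNorm_map_im_le (X : Matrix (Fin a) (Fin b) ℂ) :
    frobNorm (X.map Complex.im) ≤ frobNorm X :=
  frobNorm_le_of_norm_le fun i j => Complex.abs_im_le_norm (X i j)

theorem frobNorm_vecMulVec (v : Fin a → 𝕜) (w : Fin b → 𝕜) :
    frobNorm (Matrix.vecMulVec v w) = √(∑ i, ‖v i‖ ^ 2) * √(∑ j, ‖w j‖ ^ 2) := by
  rw [frobNorm, ← Real.sqrt_mul (sum_nonneg fun i _ => sq_nonneg _), sum_mul_sum]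
  simp [Matrix.vecMulVec_apply, mul_pow]

theorem norm_toEuclideanLin_le (X : Matrix (Fin a) (Fin b) ℝ) (v : EuclideanSpace ℝ (Fin b)) :
    ‖Matrix.toEuclideanLin X v‖ ≤ frobNorm X * ‖v‖ := by
  rw [EuclideanSpace.norm_eq, EuclideanSpace.norm_eq, frobNorm,
    ← Real.sqrt_mul (sum_nonneg fun i _ => sum_nonneg fun j _ => sq_nonneg _), sum_mul]
  refine Real.sqrt_le_sqrt (sum_le_sum fun i _ => ?_)
  simp only [Matrix.toLpLin_apply, Matrix.mulVec, dotProduct, Real.norm_eq_abs, sq_abs]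
  exact sum_mul_sq_le_sq_mul_sq _ _ _

end FrobeniusNorm

theorem opNorm2_nonneg {a b : ℕ} (X : Matrix (Fin a) (Fin b) ℝ) : 0 ≤ opNorm2 X := norm_nonneg _

attribute [local instance] Matrix.instL2OpNormedAddCommGroup in
theorem opNorm2_transpose {a b : ℕ} (X : Matrix (Fin a) (Fin b) ℝ) :
    opNorm2 Xᵀ = opNorm2 X := by
  have h : ∀ {a b : ℕ} (Y : Matrix (Fin a) (Fin b) ℝ), opNorm2 Y = ‖Y‖ := fun Y => by
    rw [Matrix.l2_opNorm_def]; rfl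
  rw [h, h, ← Matrix.conjTranspose_eq_transpose_of_trivial, Matrix.l2_opNorm_conjTranspose]

theorem sum_sq_mulVec_le {a b : ℕ} (X : Matrix (Fin a) (Fin b) ℝ) (v : Fin b → ℝ) :
    ∑ i, (X *ᵥ v) i ^ 2 ≤ opNorm2 X ^ 2 * ∑ j, v j ^ 2 := by
  have h := (LinearMap.toContinuousLinearMap (Matrix.toEuclideanLin X)).le_opNorm
    (WithLp.toLp 2 v)
  have h2 := pow_le_pow_left₀ (norm_nonneg _) h 2
  rw [mul_pow, EuclideanSpace.norm_sq_eq, EuclideanSpace.norm_sq_eq] at h2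
  simpa [Matrix.toLpLin_apply, opNorm2] using h2

theorem sum_norm_sq_map_mulVec_le {a b : ℕ} (X : Matrix (Fin a) (Fin b) ℝ) (v : Fin b → ℂ) :
    ∑ i, ‖(X.map (algebraMap ℝ ℂ) *ᵥ v) i‖ ^ 2 ≤ opNorm2 X ^ 2 * ∑ j, ‖v j‖ ^ 2 := by
  have hns : ∀ z : ℂ, ‖z‖ ^ 2 = z.re ^ 2 + z.im ^ 2 := fun z => by
    rw [← Complex.normSq_eq_norm_sq, Complex.normSq_apply]; ring
  simp only [hns, sum_add_distrib, mul_add]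
  refine add_le_add ?_ ?_
  · refine (sum_congr rfl fun i _ => ?_).trans_le (sum_sq_mulVec_le X fun j => (v j).re)
    congr 1
    simp [Matrix.mulVec, dotProduct]
  · refine (sum_congr rfl fun i _ => ?_).trans_le (sum_sq_mulVec_le X fun j => (v j).im)
    congr 1
    simp [Matrix.mulVec, dotProduct]

/-! ### Spectral decomposition of `C A^s B`, and the polynomial near its roots on the circle. -/

/-- The contribution of the `l`-th eigenvector to `C Aˢ B`. -/
def modeMatrix {d n m : ℕ} (B : Matrix (Fin d) (Fin n) ℝ) (C : Matrix (Fin m) (Fin d) ℝ)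
    (Ψ : Matrix (Fin d) (Fin d) ℂ) (l : Fin d) : Matrix (Fin m) (Fin n) ℂ :=
  Matrix.vecMulVec (fun i => (C.map (algebraMap ℝ ℂ) * Ψ) i l)
    (fun j => (Ψ⁻¹ * B.map (algebraMap ℝ ℂ)) l j)

/-- Each mode has rank one, so its norm is the product of those of a column of `C Ψ` and a row of
`Ψ⁻¹ B`. Cauchy–Schwarz over `l` then produces the two Frobenius norms, with no dependence on `d`.
-/
theorem sum_frobNorm_modeMatrix_le {d n m : ℕ} (B : Matrix (Fin d) (Fin n) ℝ)
    (C : Matrix (Fin m) (Fin d) ℝ) (Ψ : Matrix (Fin d) (Fin d) ℂ) {RΘ RΨ : ℝ}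
    (hB : opNorm2 B ≤ RΘ) (hC : opNorm2 C ≤ RΘ) (hΨ : frobNorm Ψ * frobNorm Ψ⁻¹ ≤ RΨ) :
    ∑ l, frobNorm (modeMatrix B C Ψ l) ≤ RΘ ^ 2 * RΨ := by
  have hR : 0 ≤ RΘ := (opNorm2_nonneg B).trans hB
  have hCl : ∀ l, √(∑ i, ‖(C.map (algebraMap ℝ ℂ) * Ψ) i l‖ ^ 2)
      ≤ RΘ * √(∑ i, ‖Ψ i l‖ ^ 2) := by
    intro l
    refine Real.sqrt_le_iff.2 ⟨by positivity, ?_⟩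
    rw [mul_pow, Real.sq_sqrt (sum_nonneg fun i _ => sq_nonneg _)]
    refine (sum_norm_sq_map_mulVec_le C fun i => Ψ i l).trans ?_
    have := opNorm2_nonneg C
    gcongr
  have hBl : ∀ l, √(∑ j, ‖(Ψ⁻¹ * B.map (algebraMap ℝ ℂ)) l j‖ ^ 2)
      ≤ RΘ * √(∑ i, ‖Ψ⁻¹ l i‖ ^ 2) := by
    intro l
    refine Real.sqrt_le_iff.2 ⟨by positivity, ?_⟩
    rw [mul_pow, Real.sq_sqrt (sum_nonneg fun i _ => sq_nonneg _)]
    have h := sum_norm_sq_map_mulVec_le Bᵀ fun i => Ψ⁻¹ l i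
    rw [opNorm2_transpose] at h
    have := opNorm2_nonneg B
    refine (le_of_eq ?_).trans (h.trans (by gcongr))
    refine sum_congr rfl fun j _ => ?_
    rw [Matrix.mul_apply]
    simp only [Matrix.mulVec, dotProduct, Matrix.map_apply, Matrix.transpose_apply, mul_comm]
  calc ∑ l, frobNorm (modeMatrix B C Ψ l)
      ≤ ∑ l, (RΘ * √(∑ i, ‖Ψ i l‖ ^ 2)) * (RΘ * √(∑ i, ‖Ψ⁻¹ l i‖ ^ 2)) := by
        refine sum_le_sum fun l _ => ?_
        rw [modeMatrix, frobNorm_vecMulVec]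
        exact mul_le_mul (hCl l) (hBl l) (Real.sqrt_nonneg _) (by positivity)
    _ = RΘ ^ 2 * ∑ l, √(∑ i, ‖Ψ i l‖ ^ 2) * √(∑ i, ‖Ψ⁻¹ l i‖ ^ 2) := by
        rw [mul_sum]; exact sum_congr rfl fun l _ => by ring
    _ ≤ RΘ ^ 2 * (frobNorm Ψ * frobNorm Ψ⁻¹) := by
        gcongr
        rw [frobNorm, sum_comm, frobNorm]
        exact Real.sum_sqrt_mul_sqrt_le _ (fun l => sum_nonneg fun i _ => sq_nonneg _)
          (fun l => sum_nonneg fun i _ => sq_nonneg _)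
    _ ≤ RΘ ^ 2 * RΨ := by gcongr

theorem map_mul_pow_mul_eq_sum_modeMatrix {d n m : ℕ} {A : Matrix (Fin d) (Fin d) ℝ}
    (B : Matrix (Fin d) (Fin n) ℝ) (C : Matrix (Fin m) (Fin d) ℝ)
    {Ψ : Matrix (Fin d) (Fin d) ℂ} {α : Fin d → ℂ} (hΨ : IsUnit Ψ.det)
    (hA : A.map (algebraMap ℝ ℂ) = Ψ * Matrix.diagonal α * Ψ⁻¹) (s : ℕ) :
    (C * (A ^ s * B)).map (algebraMap ℝ ℂ) = ∑ l, α l ^ s • modeMatrix B C Ψ l := by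
  have hpow : (Ψ * Matrix.diagonal α * Ψ⁻¹) ^ s = Ψ * Matrix.diagonal (α ^ s) * Ψ⁻¹ := by
    induction s with
    | zero => simp [Matrix.mul_nonsing_inv _ hΨ]
    | succ s ih =>
      rw [pow_succ, ih, pow_succ]
      calc _ = Ψ * Matrix.diagonal (α ^ s) * (Ψ⁻¹ * Ψ) * Matrix.diagonal α * Ψ⁻¹ := by
            simp only [Matrix.mul_assoc]
        _ = _ := by
            rw [Matrix.nonsing_inv_mul _ hΨ, Matrix.mul_one, Matrix.mul_assoc Ψ,
              Matrix.diagonal_mul_diagonal]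
            rfl
  rw [Matrix.map_mul, Matrix.map_mul, Matrix.map_pow, hA, hpow]
  have : C.map (algebraMap ℝ ℂ) * (Ψ * Matrix.diagonal (α ^ s) * Ψ⁻¹ * B.map (algebraMap ℝ ℂ))
      = (C.map (algebraMap ℝ ℂ) * Ψ) * Matrix.diagonal (α ^ s) * (Ψ⁻¹ * B.map (algebraMap ℝ ℂ)) := by
    simp only [Matrix.mul_assoc]
  rw [this]
  ext i j
  rw [Matrix.mul_apply, Matrix.sum_apply]
  refine sum_congr rfl fun l _ => ?_
  rw [Matrix.mul_diagonal, Matrix.smul_apply, modeMatrix, Matrix.vecMulVec_apply, Pi.pow_apply,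
    smul_eq_mul]
  ring

theorem norm_le_one_of_spectralRadius_le {d : ℕ} {X Ψ : Matrix (Fin d) (Fin d) ℂ}
    {α : Fin d → ℂ} (hΨ : IsUnit Ψ.det) (hX : X = Ψ * Matrix.diagonal α * Ψ⁻¹)
    (hρ : spectralRadius ℂ X ≤ 1) (l : Fin d) : ‖α l‖ ≤ 1 := by
  have hmem : α l ∈ spectrum ℂ X := by
    obtain ⟨U, hU⟩ := (Matrix.isUnit_iff_isUnit_det Ψ).2 hΨ
    have hXU : X = (U : Matrix (Fin d) (Fin d) ℂ) * Matrix.diagonal α * (↑U⁻¹ : Matrix (Fin d) (Fin d) ℂ) := by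
      rw [hX, ← hU, Matrix.coe_units_inv]
    rw [hXU, spectrum.units_conjugate, spectrum_diagonal]
    exact Set.mem_range_self l
  have h := (le_iSup₂ (f := fun (z : ℂ) (_ : z ∈ spectrum ℂ X) => (‖z‖₊ : ENNReal))
    (α l) hmem).trans hρ
  exact_mod_cast h

theorem one_le_polyL1 {p : Polynomial ℝ} (hp : p.Monic) : 1 ≤ polyL1 p := by
  have h := single_le_sum (f := fun i => |p.coeff i|) (fun i _ => abs_nonneg _)
    (self_mem_range_succ p.natDegree)
  rw [polyL1]
  simpa [hp.coeff_natDegree] using h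

/-- Compare `p (ω r)` with `p ω = 0` monomial by monomial. The factor `1 - r` gained here is the one
built into `geomVec`. -/
theorem norm_aeval_mul_le {p : Polynomial ℝ} {ω : ℂ} {r : ℝ} (hω : ‖ω‖ = 1)
    (hp : Polynomial.aeval ω p = 0) (h0 : 0 ≤ r) (h1 : r ≤ 1) :
    ‖Polynomial.aeval (ω * r) p‖ ≤ polyL1 p * (p.natDegree * (1 - r)) := by
  rw [← sub_zero (Polynomial.aeval (ω * r) p), ← hp, Polynomial.aeval_eq_sum_range,
    Polynomial.aeval_eq_sum_range, ← sum_sub_distrib, polyL1, sum_mul]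
  refine norm_sum_le_of_le _ fun i hi => ?_
  rw [← smul_sub, norm_smul, Real.norm_eq_abs]
  gcongr
  refine (norm_pow_sub_pow_le_of_norm_le_one ?_ hω.le i).trans ?_
  · rw [norm_mul, hω, one_mul, Complex.norm_real, Real.norm_of_nonneg h0]; exact h1
  · have : ‖ω * r - ω‖ = 1 - r := by
      rw [← mul_sub_one, norm_mul, hω, one_mul, ← Complex.ofReal_one, ← Complex.ofReal_sub,
        Complex.norm_real, Real.norm_of_nonpos (by linarith)]
      ring
    rw [this]
    have : i ≤ p.natDegree := Nat.lt_succ_iff.1 (mem_range.1 hi)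
    gcongr

/-! ### The autoregressive combination of outputs as a convolution of inputs. -/

section Dynamics

variable {d n m T : ℕ} (A : Matrix (Fin d) (Fin d) ℝ) (B : Matrix (Fin d) (Fin n) ℝ)
  (C : Matrix (Fin m) (Fin d) ℝ) (x : ℕ → EuclideanSpace ℝ (Fin n))

theorem toEuclideanLin_mul_apply {a b c : ℕ} (X : Matrix (Fin a) (Fin b) ℝ)
    (Y : Matrix (Fin b) (Fin c) ℝ) (v : EuclideanSpace ℝ (Fin c)) :
    Matrix.toEuclideanLin (X * Y) v = Matrix.toEuclideanLin X (Matrix.toEuclideanLin Y v) := by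
  simp [Matrix.toLpLin_apply, Matrix.mulVec_mulVec]

theorem ldsState_eq_sum (t : ℕ) :
    ldsState A B x t = ∑ s ∈ range t, Matrix.toEuclideanLin (A ^ s * B) (x (t - s)) := by
  induction t with
  | zero => rfl
  | succ t ih =>
    rw [ldsState, ih, map_sum, sum_range_succ']
    simp only [pow_zero, Matrix.one_mul, Nat.sub_zero, Nat.add_sub_add_right, pow_succ',
      Matrix.mul_assoc, toEuclideanLin_mul_apply]

theorem delayed_ldsOutput_eq_sum {S t : ℕ} (ht : t ≤ S) (u : ℕ) :
    delayed (ldsOutput A B C x) t u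
      = ∑ s ∈ range S, Matrix.toEuclideanLin (C * (A ^ s * B)) (delayed x t (s + u)) := by
  have hsub : range (t - u) ⊆ range S := range_mono (by omega)
  rw [← sum_subset hsub]
  · rw [delayed]
    split_ifs with hu
    · rw [ldsOutput, ldsState_eq_sum, map_sum]
      refine sum_congr rfl fun s hs => ?_
      have := mem_range.1 hs
      rw [delayed, if_pos (by omega), Nat.sub_sub, Nat.add_comm u s]
      simp only [toEuclideanLin_mul_apply]
    · rw [Nat.sub_eq_zero_of_le (by omega)]; simp
  · intro s _ hs
    rw [mem_range] at hs
    rw [delayed, if_neg (by omega), map_zero]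

/-- The weight of `x_{t-j}` in `∑_u c_u y_{t-u}`, where `c_u` is the coefficient of `X^{τ-u}` in
`p`. -/
def arWeight (p : Polynomial ℝ) (j : ℕ) : Matrix (Fin m) (Fin n) ℝ :=
  ∑ u ∈ range (p.natDegree + 1),
    if u ≤ j then p.coeff (p.natDegree - u) • (C * (A ^ (j - u) * B)) else 0

theorem sum_coeff_smul_delayed_ldsOutput (p : Polynomial ℝ) {t : ℕ} (ht : t ≤ T) :
    ∑ u ∈ range (p.natDegree + 1),
        p.coeff (p.natDegree - u) • delayed (ldsOutput A B C x) t u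
      = ∑ j ∈ range (p.natDegree + T),
        Matrix.toEuclideanLin (arWeight A B C p j) (delayed x t j) := by
  simp only [arWeight, map_sum, LinearMap.sum_apply]
  rw [sum_comm]
  refine sum_congr rfl fun u hu => ?_
  have hu' : u ≤ p.natDegree := Nat.lt_succ_iff.1 (mem_range.1 hu)
  -- After the lag `u` there remain `S ≥ T ≥ t` delays, enough to carry all of `y_{t-u}`; the
  -- surplus terms vanish.
  obtain ⟨S, hS⟩ : ∃ S, p.natDegree + T = u + S := ⟨p.natDegree + T - u, by omega⟩
  rw [delayed_ldsOutput_eq_sum A B C x (S := S) (by omega), hS, sum_range_add _ u S,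
    sum_eq_zero (s := range u), zero_add, smul_sum]
  · refine sum_congr rfl fun s _ => ?_
    rw [if_pos (by omega), Nat.add_sub_cancel_left, map_smul, LinearMap.smul_apply,
      Nat.add_comm u s]
  · intro j hj
    have := mem_range.1 hj
    rw [if_neg (by omega), map_zero, LinearMap.zero_apply]

variable {A}

theorem frobNorm_arWeight_le {Ψ : Matrix (Fin d) (Fin d) ℂ} {α : Fin d → ℂ} {R : ℝ}
    (hΨ : IsUnit Ψ.det) (hA : A.map (algebraMap ℝ ℂ) = Ψ * Matrix.diagonal α * Ψ⁻¹)
    (hα : ∀ l, ‖α l‖ ≤ 1) (hR : ∑ l, frobNorm (modeMatrix B C Ψ l) ≤ R) (p : Polynomial ℝ)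
    (j : ℕ) : frobNorm (arWeight A B C p j) ≤ polyL1 p * R := by
  have hCAB : ∀ s, frobNorm (C * (A ^ s * B)) ≤ R := by
    intro s
    have h : frobNorm (C * (A ^ s * B)) = frobNorm ((C * (A ^ s * B)).map (algebraMap ℝ ℂ)) := by
      simp [frobNorm]
    rw [h, map_mul_pow_mul_eq_sum_modeMatrix B C hΨ hA]
    refine (frobNorm_sum_le _ _).trans (le_trans (sum_le_sum fun l _ => ?_) hR)
    rw [frobNorm_smul, norm_pow]
    exact mul_le_of_le_one_left (frobNorm_nonneg _) (pow_le_one₀ (norm_nonneg _) (hα l))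
  have hR0 : 0 ≤ R := (frobNorm_nonneg _).trans (hCAB 0)
  calc frobNorm (arWeight A B C p j)
      ≤ ∑ u ∈ range (p.natDegree + 1), |p.coeff (p.natDegree - u)| * R := by
        refine (frobNorm_sum_le _ _).trans (sum_le_sum fun u _ => ?_)
        split_ifs
        · rw [frobNorm_smul, Real.norm_eq_abs]
          exact mul_le_mul_of_nonneg_left (hCAB _) (abs_nonneg _)
        · rw [frobNorm_zero]; positivity
    _ = polyL1 p * R := by
        rw [← sum_mul, polyL1, ← sum_range_reflect]
        congr 1
        refine sum_congr rfl fun u hu => ?_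
        have := mem_range.1 hu
        congr 2
        omega

/-- From delay `τ` on, every lag `u ≤ τ` contributes, so on each mode the coefficients reassemble to
the full value `p (α l)`. -/
theorem map_arWeight_add {Ψ : Matrix (Fin d) (Fin d) ℂ} {α : Fin d → ℂ}
    (hΨ : IsUnit Ψ.det) (hA : A.map (algebraMap ℝ ℂ) = Ψ * Matrix.diagonal α * Ψ⁻¹)
    (p : Polynomial ℝ) (s : ℕ) :
    (arWeight A B C p (p.natDegree + s)).map (algebraMap ℝ ℂ)
      = ∑ l, (α l ^ s * Polynomial.aeval (α l) p) • modeMatrix B C Ψ l := by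
  have h1 : (arWeight A B C p (p.natDegree + s)).map (algebraMap ℝ ℂ)
      = ∑ u ∈ range (p.natDegree + 1), (p.coeff (p.natDegree - u) : ℂ) •
        ∑ l, α l ^ (p.natDegree + s - u) • modeMatrix B C Ψ l := by
    ext i j
    simp only [← map_mul_pow_mul_eq_sum_modeMatrix B C hΨ hA, arWeight, Matrix.map_apply,
      Matrix.sum_apply, map_sum]
    refine sum_congr rfl fun u hu => ?_
    have := mem_range.1 hu
    rw [if_pos (by omega)]
    simp
  rw [h1]
  simp only [smul_sum]
  rw [sum_comm]
  refine sum_congr rfl fun l _ => ?_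
  simp only [smul_smul, ← sum_smul]
  congr 1
  rw [Polynomial.aeval_eq_sum_range, mul_sum, ← sum_range_reflect]
  refine sum_congr rfl fun u hu => ?_
  have hu' := mem_range.1 hu
  have e1 : p.natDegree + 1 - 1 - u = p.natDegree - u := by omega
  have e2 : p.natDegree + s - (p.natDegree - u) = u + s := by omega
  have e3 : p.natDegree - (p.natDegree - u) = u := by omega
  rw [e1, e2, e3, Complex.real_smul, pow_add]
  ring

end Dynamics

/-! ### Combining filters and phases. -/

section Filters

variable {T k W m n : ℕ}

/-- The weight that the filters and phases give to the input with delay `s`. -/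
def filterWeight (hk : k ≤ T) (σ : Fin T → ℝ) (φ : Fin T → EuclideanSpace ℝ (Fin T))
    (M N : Fin W → Fin k → Matrix (Fin m) (Fin n) ℝ) (s : Fin T) : Matrix (Fin m) (Fin n) ℝ :=
  ∑ p : Fin W, ∑ h : Fin k, (σ (Fin.castLE hk h) ^ (1 / 4 : ℝ) * φ (Fin.castLE hk h) s) •
    (Real.cos (2 * Real.pi * (((s : ℕ) : ℝ) + 1) * ((p : ℕ) : ℝ) / (W : ℝ)) • M p h
      + Real.sin (2 * Real.pi * (((s : ℕ) : ℝ) + 1) * ((p : ℕ) : ℝ) / (W : ℝ)) • N p h)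

theorem PseudoLDS.predict_eq {τ : ℕ} (Θ : PseudoLDS W k τ m n) (hk : k ≤ T)
    (σ : Fin T → ℝ) (φ : Fin T → EuclideanSpace ℝ (Fin T))
    (x : ℕ → EuclideanSpace ℝ (Fin n)) (y : ℕ → EuclideanSpace ℝ (Fin m)) (t : ℕ) :
    Θ.predict hk σ φ x y t = ∑ u : Fin τ, Θ.e u • delayed y t (u + 1)
      + ∑ j : Fin τ, Matrix.toEuclideanLin (Θ.P j) (delayed x t j)
      + ∑ s : Fin T, Matrix.toEuclideanLin (filterWeight hk σ φ Θ.M Θ.N s)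
        (delayed x t (τ + s)) := by
  rw [PseudoLDS.predict]
  congr 1
  simp only [filterWeight, delayedConv, map_sum, LinearMap.sum_apply]
  symm
  rw [sum_comm]
  refine sum_congr rfl fun p _ => ?_
  rw [sum_comm]
  refine sum_congr rfl fun h _ => ?_
  rw [← sum_add_distrib, smul_sum]
  refine sum_congr rfl fun s _ => ?_
  simp only [map_smul, map_add, LinearMap.smul_apply, LinearMap.add_apply, smul_add, smul_smul,
    mul_assoc]

theorem sqrt_sum_sq_le_of_le {ι : Type*} (s : Finset ι) {f : ι → ℝ} {b : ℝ} (hf : ∀ i ∈ s, 0 ≤ f i)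
    (h : ∀ i ∈ s, f i ≤ b) (hb : 0 ≤ b) : √(∑ i ∈ s, f i ^ 2) ≤ √(s.card) * b := by
  rw [Real.sqrt_le_iff]
  refine ⟨by positivity, ?_⟩
  rw [mul_pow, Real.sq_sqrt (Nat.cast_nonneg _)]
  calc ∑ i ∈ s, f i ^ 2 ≤ ∑ i ∈ s, b ^ 2 :=
        sum_le_sum fun i hi => pow_le_pow_left₀ (hf i hi) (h i hi) 2
    _ = _ := by simp

/-- Approximation of a sum of modes `ω^s (1 - r) r^s` by filters and phases. -/
theorem IsWaveFilters.exists_filterWeight_near {σ : Fin T → ℝ}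
    {φ : Fin T → EuclideanSpace ℝ (Fin T)} (hφ : IsWaveFilters T σ φ) (hk : k ≤ T) (hW : 0 < W)
    {ι : Type*} [Fintype ι] (ω : ι → ℂ) (r : ι → ℝ) (G : ι → Matrix (Fin m) (Fin n) ℂ)
    (hω : ∀ l, ‖ω l‖ = 1) (h0 : ∀ l, 0 ≤ r l) (h1 : ∀ l, r l ≤ 1) {η : ℝ}
    (hη : ∀ r, 0 ≤ r → r ≤ 1 → ∑ s, |geomVec T r s - filterProj hk φ r s| ≤ η) :
    ∃ M N : Fin W → Fin k → Matrix (Fin m) (Fin n) ℝ,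
      tensorNorm21 M ≤ 2 * √k * ∑ l, frobNorm (G l) ∧
      tensorNorm21 N ≤ 2 * √k * ∑ l, frobNorm (G l) ∧
      ∑ s : Fin T, frobNorm (filterWeight hk σ φ M N s
          - (∑ l, (ω l ^ (s : ℕ) * (geomVec T (r l) s : ℂ)) • G l).map Complex.re)
        ≤ (2 * Real.pi * T / W + η) * ∑ l, frobNorm (G l) := by
  choose ph hph using fun l => Complex.exists_rootOfUnity_near hW (hω l)
  set θ : Fin W → ℝ := fun p => 2 * Real.pi * (p : ℕ) / W with hθ
  set g : Fin k → ι → ℝ := fun h l =>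
    inner ℝ (φ (Fin.castLE hk h)) (geomVec T (r l)) with hg
  set κ : Fin k → ℝ := fun h => σ (Fin.castLE hk h) ^ (1 / 4 : ℝ) with hκ
  have hκ0 : ∀ h, 0 ≤ κ h := fun h => Real.rpow_nonneg (hφ.nonneg _) _
  have hgκ : ∀ h l, |g h l| ≤ 2 * κ h := fun h l => hφ.abs_inner_geomVec_le _ (h0 l) (h1 l)
  -- Each mode is assigned to the root of unity nearest its phase. The factor `(ω l)⁻¹` compensates
  -- for the 1-based index in the cosine and sine, which yields the power `s + 1` instead of `s`.
  set H : Fin W → Fin k → Matrix (Fin m) (Fin n) ℂ := fun p h =>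
    ∑ l, if ph l = p then ((ω l)⁻¹ * ((g h l / κ h : ℝ) : ℂ)) • G l else 0 with hH
  set S : Fin W → ℝ := fun p => ∑ l, if ph l = p then 2 * frobNorm (G l) else 0 with hS
  have hS0 : ∀ p, 0 ≤ S p := fun p => sum_nonneg fun l _ => by
    have := frobNorm_nonneg (G l)
    split_ifs <;> positivity
  have hHS : ∀ p h, frobNorm (H p h) ≤ S p := by
    intro p h
    refine (frobNorm_sum_le _ _).trans (sum_le_sum fun l _ => ?_)
    split_ifs
    · rw [frobNorm_smul, norm_mul, norm_inv, hω, inv_one, one_mul, Complex.norm_real,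
        Real.norm_eq_abs, abs_div, abs_of_nonneg (hκ0 h)]
      exact mul_le_mul_of_nonneg_right (div_le_of_le_mul₀ (hκ0 h) zero_le_two (hgκ h l))
        (frobNorm_nonneg _)
    · rw [frobNorm_zero]
  -- Each mode belongs to exactly one phase, so the sum over phases does not grow with `W`.
  have hSsum : ∑ p, S p = 2 * ∑ l, frobNorm (G l) := by
    rw [hS, sum_comm, mul_sum]
    simp
  have hnorm : ∀ X : Fin W → Fin k → Matrix (Fin m) (Fin n) ℝ,
      (∀ p h, frobNorm (X p h) ≤ frobNorm (H p h)) →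
      tensorNorm21 X ≤ 2 * √k * ∑ l, frobNorm (G l) := by
    intro X hX
    calc tensorNorm21 X ≤ ∑ p, √k * S p := by
          refine sum_le_sum fun p _ => ?_
          have := sqrt_sum_sq_le_of_le univ (f := fun h => frobNorm (X p h))
            (fun h _ => frobNorm_nonneg _) (fun h _ => (hX p h).trans (hHS p h)) (hS0 p)
          simpa using this
      _ = 2 * √k * ∑ l, frobNorm (G l) := by rw [← mul_sum, hSsum]; ring
  -- The minus sign comes from `Re (exp(iθ) H) = cos θ Re H - sin θ Im H`.
  refine ⟨fun p h => (H p h).map Complex.re, fun p h => -(H p h).map Complex.im,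
    hnorm _ fun p h => frobNorm_map_re_le _,
    hnorm _ fun p h => (frobNorm_neg _).trans_le (frobNorm_map_im_le _), ?_⟩
  have hweight : ∀ s, filterWeight hk σ φ (fun p h => (H p h).map Complex.re)
      (fun p h => -(H p h).map Complex.im) s
      = (∑ l, ((ω l)⁻¹ * Complex.exp (θ (ph l) * Complex.I) ^ ((s : ℕ) + 1)
        * (filterProj hk φ (r l) s : ℂ)) • G l).map Complex.re := by
    intro s
    have e1 : ∀ (p : Fin W) (h : Fin k), (σ (Fin.castLE hk h) ^ (1 / 4 : ℝ) * φ (Fin.castLE hk h) s) •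
        (Real.cos (2 * Real.pi * (((s : ℕ) : ℝ) + 1) * ((p : ℕ) : ℝ) / (W : ℝ))
            • (H p h).map Complex.re
          + Real.sin (2 * Real.pi * (((s : ℕ) : ℝ) + 1) * ((p : ℕ) : ℝ) / (W : ℝ))
            • -(H p h).map Complex.im)
        = (((κ h * φ (Fin.castLE hk h) s : ℝ) * Complex.exp (θ p * Complex.I) ^ ((s : ℕ) + 1) : ℂ)
          • H p h).map Complex.re := by
      intro p h
      have e2 : Complex.exp (θ p * Complex.I) ^ ((s : ℕ) + 1)
          = (Real.cos (2 * Real.pi * (((s : ℕ) : ℝ) + 1) * ((p : ℕ) : ℝ) / (W : ℝ)) : ℂ)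
            + (Real.sin (2 * Real.pi * (((s : ℕ) : ℝ) + 1) * ((p : ℕ) : ℝ) / (W : ℝ)) : ℂ)
              * Complex.I := by
        rw [← Complex.exp_nat_mul, Complex.ofReal_cos, Complex.ofReal_sin,
          ← Complex.exp_mul_I]
        congr 1
        simp only [hθ]
        push_cast
        ring
      rw [e2]
      ext i j
      simp [-Complex.ofReal_cos, -Complex.ofReal_sin, hκ]
      ring
    -- A vanishing eigenvalue is harmless: the bound `|g| ≤ 2 κ` then forces `g = 0`.
    have hcancel : ∀ h l, κ h * (g h l / κ h) = g h l := by
      intro h l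
      rcases eq_or_ne (κ h) 0 with hz | hz
      · have := hgκ h l
        rw [hz, mul_zero] at this
        rw [hz, zero_mul, abs_nonpos_iff.1 this]
      · field_simp
    have e3 : ∀ l, (filterProj hk φ (r l) s : ℂ)
        = ∑ h : Fin k, ((g h l * φ (Fin.castLE hk h) s : ℝ) : ℂ) := by
      intro l
      simp [filterProj, hg]
    rw [filterWeight]
    simp only [e1]
    have e4 : (∑ l, ((ω l)⁻¹ * Complex.exp (θ (ph l) * Complex.I) ^ ((s : ℕ) + 1)
        * (filterProj hk φ (r l) s : ℂ)) • G l)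
        = ∑ p, ∑ h, ((κ h * φ (Fin.castLE hk h) s : ℝ)
          * Complex.exp (θ p * Complex.I) ^ ((s : ℕ) + 1) : ℂ) • H p h := by
      simp only [hH, smul_sum, smul_ite, smul_zero, e3, mul_sum, sum_smul]
      refine Eq.symm ((sum_congr rfl fun p _ => sum_comm).trans
        (sum_comm.trans (sum_congr rfl fun l _ => ?_)))
      rw [sum_comm]
      refine sum_congr rfl fun h _ => ?_
      rw [sum_ite_eq univ (ph l), if_pos (mem_univ _), smul_smul]
      congr 1
      have e := congrArg (fun z : ℝ => (z : ℂ)) (hcancel h l)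
      push_cast at e ⊢
      linear_combination (φ (Fin.castLE hk h) s
        * Complex.exp (θ (ph l) * Complex.I) ^ ((s : ℕ) + 1) * (ω l)⁻¹ : ℂ) * e
    rw [e4]
    ext i j
    simp only [Matrix.sum_apply, Matrix.map_apply, Complex.re_sum]
  have hbr : ∀ l (s : Fin T), ‖(ω l)⁻¹ * Complex.exp (θ (ph l) * Complex.I) ^ ((s : ℕ) + 1)
        * (filterProj hk φ (r l) s : ℂ) - ω l ^ (s : ℕ) * (geomVec T (r l) s : ℂ)‖
      ≤ 2 * Real.pi * T / W * geomVec T (r l) s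
        + |geomVec T (r l) s - filterProj hk φ (r l) s| := by
    intro l s
    have hωl : ω l ≠ 0 := fun h => by simpa [h] using hω l
    have hgn : 0 ≤ geomVec T (r l) s := by
      have := h0 l
      have := h1 l
      have : 0 ≤ 1 - r l := by linarith
      rw [geomVec_apply]; positivity
    -- Split into the phase error acting on `geomVec` and the projection error carrying a unimodular
    -- factor.
    have e : (ω l)⁻¹ * Complex.exp (θ (ph l) * Complex.I) ^ ((s : ℕ) + 1)
        * (filterProj hk φ (r l) s : ℂ) - ω l ^ (s : ℕ) * (geomVec T (r l) s : ℂ)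
        = -((ω l)⁻¹ * (ω l ^ ((s : ℕ) + 1) - Complex.exp (θ (ph l) * Complex.I) ^ ((s : ℕ) + 1))
            * (geomVec T (r l) s : ℂ))
          - (ω l)⁻¹ * Complex.exp (θ (ph l) * Complex.I) ^ ((s : ℕ) + 1)
            * ((geomVec T (r l) s - filterProj hk φ (r l) s : ℝ) : ℂ) := by
      rw [pow_succ (ω l)]
      push_cast
      field_simp
      ring
    rw [e]
    refine (norm_sub_le _ _).trans (add_le_add ?_ ?_)
    · rw [norm_neg, norm_mul, norm_mul, norm_inv, hω, inv_one, one_mul, Complex.norm_real,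
        Real.norm_of_nonneg hgn]
      refine mul_le_mul_of_nonneg_right ?_ hgn
      refine (norm_pow_sub_pow_le_of_norm_le_one (hω l).le
        (Complex.norm_exp_ofReal_mul_I _).le _).trans ?_
      calc (((s : ℕ) + 1 : ℕ) : ℝ) * ‖ω l - Complex.exp (θ (ph l) * Complex.I)‖
          ≤ T * (2 * Real.pi / W) := by
            gcongr
            · exact s.2
            · exact hph l
        _ = 2 * Real.pi * T / W := by ring
    · rw [norm_mul, norm_mul, norm_inv, hω, norm_pow, Complex.norm_exp_ofReal_mul_I,
        Complex.norm_real, Real.norm_eq_abs]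
      simp
  calc _ ≤ ∑ s : Fin T, ∑ l, (2 * Real.pi * T / W * geomVec T (r l) s
        + |geomVec T (r l) s - filterProj hk φ (r l) s|) * frobNorm (G l) := by
        refine sum_le_sum fun s _ => ?_
        rw [hweight, ← Matrix.map_sub _ (fun _ _ => Complex.sub_re _ _), ← sum_sub_distrib]
        refine (frobNorm_map_re_le _).trans ((frobNorm_sum_le _ _).trans
          (sum_le_sum fun l _ => ?_))
        rw [← sub_smul, frobNorm_smul]
        exact mul_le_mul_of_nonneg_right (hbr l s) (frobNorm_nonneg _)
    _ = ∑ l, (2 * Real.pi * T / W * ∑ s, geomVec T (r l) s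
        + ∑ s, |geomVec T (r l) s - filterProj hk φ (r l) s|) * frobNorm (G l) := by
        rw [sum_comm]
        refine sum_congr rfl fun l _ => ?_
        rw [← sum_mul, sum_add_distrib, mul_sum]
    _ ≤ ∑ l, (2 * Real.pi * T / W + η) * frobNorm (G l) := by
        refine sum_le_sum fun l _ => mul_le_mul_of_nonneg_right (add_le_add ?_ ?_)
          (frobNorm_nonneg _)
        · exact mul_le_of_le_one_right (by positivity) (sum_geomVec_le_one (h0 l))
        · exact hη _ (h0 l) (h1 l)
    _ = _ := by rw [mul_sum]

end Filters

/-! ### Choice of the number of filters. -/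

/-- Enough Taylor terms `q` and dyadic intervals `L` for a given accuracy. -/
theorem exists_approx_parameters {T : ℕ} (hT : 2 ≤ T) {X : ℝ} (hX : 1 < X) :
    ∃ q L : ℕ, T ≤ 2 ^ L ∧ 12 * (T : ℝ) ^ 4 * (T * (441 * (1 / 9) ^ q)) ≤ (1 / (2 * X)) ^ 4 ∧
      ((q * (L + 1) : ℕ) : ℝ) ≤ 60 * (Real.log T * Real.log (X * T)) := by
  have hT2 : (2 : ℝ) ≤ T := by exact_mod_cast hT
  have hXT2 : 2 ≤ X * T := by nlinarith
  have hXTpos : 0 < X * T := by linarith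
  have hl2 := Real.log_two_gt_d9
  have hlT : Real.log 2 ≤ Real.log T := Real.log_le_log two_pos hT2
  have hlXT : Real.log 2 ≤ Real.log (X * T) := Real.log_le_log two_pos hXT2
  refine ⟨⌈11 * Real.log (X * T)⌉₊, Nat.log 2 T + 1, (Nat.lt_pow_succ_log_self one_lt_two T).le,
    ?_, ?_⟩
  · set q := ⌈11 * Real.log (X * T)⌉₊
    have hq : 11 * Real.log (X * T) ≤ q := Nat.le_ceil _
    -- From `exp 2 ≤ 9`. Of the 22 powers, 5 absorb `X ^ 4 * T ^ 5` and 17 absorb the constant `12 *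
    -- 441 * 16 ≤ 2 ^ 17`, as `X * T ≥ 2`.
    have h9 : (X * T) ^ 22 ≤ 9 ^ q := by
      calc (X * T) ^ 22 = Real.exp (22 * Real.log (X * T)) := by
            rw [← Real.exp_log hXTpos, ← Real.exp_nat_mul, Real.log_exp]; norm_num
        _ ≤ Real.exp (q * 2) := Real.exp_le_exp.2 (by linarith)
        _ = Real.exp 2 ^ q := Real.exp_nat_mul _ _
        _ ≤ 9 ^ q := by
            gcongr
            rw [show (2 : ℝ) = 1 + 1 by norm_num, Real.exp_add]
            have := Real.exp_one_lt_d9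
            have := Real.exp_pos 1
            nlinarith
    have h17 : (2 : ℝ) ^ 17 ≤ (X * T) ^ 17 := by gcongr
    have h5 : X ^ 4 * (T : ℝ) ^ 5 ≤ (X * T) ^ 5 := by
      rw [mul_pow]
      gcongr
      · exact hX.le
      · norm_num
    have hmul : 12 * 441 * 16 * (X ^ 4 * (T : ℝ) ^ 5) ≤ 9 ^ q := by
      calc _ ≤ (2 : ℝ) ^ 17 * (X ^ 4 * (T : ℝ) ^ 5) := by gcongr; norm_num
        _ ≤ (X * T) ^ 17 * (X * T) ^ 5 := by gcongr
        _ = (X * T) ^ 22 := by ring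
        _ ≤ _ := h9
    rw [div_pow, div_pow, one_pow, one_pow, le_div_iff₀ (by positivity)]
    calc _ = 12 * 441 * 16 * (X ^ 4 * (T : ℝ) ^ 5) / 9 ^ q := by ring
      _ ≤ 1 := (div_le_one (by positivity)).2 hmul
  · have hq : (⌈11 * Real.log (X * T)⌉₊ : ℝ) ≤ 12.5 * Real.log (X * T) := by
      have := Nat.ceil_lt_add_one (a := 11 * Real.log (X * T)) (by linarith)
      linarith
    have hL : ((Nat.log 2 T : ℕ) : ℝ) * Real.log 2 ≤ Real.log T := by
      rw [← Real.log_pow]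
      refine Real.log_le_log (by positivity) ?_
      exact_mod_cast Nat.pow_log_le_self 2 (by omega)
    have hL2 : ((Nat.log 2 T : ℕ) : ℝ) + 2 ≤ 4.5 * Real.log T := by
      have h0 : (0 : ℝ) ≤ (Nat.log 2 T : ℕ) := Nat.cast_nonneg _
      nlinarith
    push_cast
    have h0 : (0 : ℝ) ≤ (Nat.log 2 T : ℕ) := Nat.cast_nonneg _
    calc _ ≤ 12.5 * Real.log (X * T) * (4.5 * Real.log T) :=
          mul_le_mul hq (by linarith) (by positivity) (by linarith)
      _ ≤ _ := by
          have : 0 ≤ Real.log T * Real.log (X * T) :=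
            mul_nonneg (by linarith) (by linarith)
          linarith

theorem IsWaveFilters.exists_card_filters {T : ℕ} {σ : Fin T → ℝ}
    {φ : Fin T → EuclideanSpace ℝ (Fin T)} (h : IsWaveFilters T σ φ) (hT : 2 ≤ T) {X : ℝ}
    (hX : 1 < X) :
    ∃ (k : ℕ) (hk : k ≤ T), (k : ℝ) ≤ 60 * (Real.log T * Real.log (X * T)) ∧
      ∀ r, 0 ≤ r → r ≤ 1 → ∑ s, |geomVec T r s - filterProj hk φ r s| ≤ 1 / (2 * X) := by
  obtain ⟨q, L, hL, hq, hqL⟩ := exists_approx_parameters hT hX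
  refine ⟨min (q * (L + 1)) T, min_le_right _ _, le_trans ?_ hqL, fun r h0 h1 => ?_⟩
  · exact_mod_cast min_le_left _ _
  · refine le_of_pow_le_pow_left₀ (n := 4) (by norm_num) (by positivity) (le_trans ?_ hq)
    refine h.sum_abs_geomVec_sub_filterProj_pow_four_le _ (by positivity) (fun i hi => ?_) h0 h1
    have := i.2
    exact h.eigenvalue_le hL q i (by omega)

/-! ### The prediction error as a convolution over delays at least `τ`. -/

section Residual

variable {d n m T k W : ℕ}

/-- Monicity isolates `y_t` in the autoregressive identity. With these `e` and `P` the past outputs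
and the first `τ` input terms cancel exactly. -/
theorem PseudoLDS.predict_sub_eq {p : Polynomial ℝ} (hp : p.Monic)
    (A : Matrix (Fin d) (Fin d) ℝ) (B : Matrix (Fin d) (Fin n) ℝ) (C : Matrix (Fin m) (Fin d) ℝ)
    (Θ : PseudoLDS W k p.natDegree m n)
    (he : ∀ u, Θ.e u = -p.coeff (p.natDegree - ((u : ℕ) + 1)))
    (hP : ∀ j, Θ.P j = arWeight A B C p j) (hk : k ≤ T) (σ : Fin T → ℝ)
    (φ : Fin T → EuclideanSpace ℝ (Fin T)) (x : ℕ → EuclideanSpace ℝ (Fin n)) {t : ℕ}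
    (ht0 : 0 < t) (ht : t ≤ T) :
    Θ.predict hk σ φ x (ldsOutput A B C x) t - ldsOutput A B C x t
      = ∑ s : Fin T, Matrix.toEuclideanLin
        (filterWeight hk σ φ Θ.M Θ.N s - arWeight A B C p (p.natDegree + s))
        (delayed x t (p.natDegree + s)) := by
  have h := sum_coeff_smul_delayed_ldsOutput A B C x p ht
  rw [sum_range_succ', sum_range_add _ p.natDegree T] at h
  simp only [Nat.sub_zero, hp.coeff_natDegree, one_smul] at h
  have h0 : delayed (ldsOutput A B C x) t 0 = ldsOutput A B C x t := by simp [delayed, ht0]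
  rw [h0] at h
  rw [Θ.predict_eq]
  simp only [he, hP, map_sub, LinearMap.sub_apply, sum_sub_distrib, neg_smul, sum_neg_distrib]
  rw [Fin.sum_univ_eq_sum_range (fun u => p.coeff (p.natDegree - (u + 1)) •
      delayed (ldsOutput A B C x) t (u + 1)),
    Fin.sum_univ_eq_sum_range (fun j => Matrix.toEuclideanLin (arWeight A B C p j)
      (delayed x t j)),
    Fin.sum_univ_eq_sum_range (fun s => Matrix.toEuclideanLin (arWeight A B C p (p.natDegree + s))
      (delayed x t (p.natDegree + s)))]
  rw [← eq_sub_iff_add_eq'] at h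
  rw [h]
  abel

theorem norm_sum_toEuclideanLin_delayed_le {τ : ℕ} (D : Fin T → Matrix (Fin m) (Fin n) ℝ) {Rx : ℝ}
    (hRx : 0 ≤ Rx) {x : ℕ → EuclideanSpace ℝ (Fin n)}
    (hx : ∀ t ∈ Finset.Icc 1 T, ‖x t‖ ≤ Rx) {t : ℕ} (ht : t ≤ T) :
    ‖∑ s : Fin T, Matrix.toEuclideanLin (D s) (delayed x t (τ + s))‖
      ≤ (∑ s, frobNorm (D s)) * Rx := by
  rw [sum_mul]
  refine norm_sum_le_of_le _ fun s _ => (norm_toEuclideanLin_le _ _).trans ?_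
  refine mul_le_mul_of_nonneg_left ?_ (frobNorm_nonneg _)
  rw [delayed]
  split_ifs with h
  · exact hx _ (Finset.mem_Icc.2 (by omega))
  · simpa using hRx

end Residual

/-! ### The residual weights as phased geometric modes. -/

section Modes

variable {d n m : ℕ} (B : Matrix (Fin d) (Fin n) ℝ) (C : Matrix (Fin m) (Fin d) ℝ)
  (Ψ : Matrix (Fin d) (Fin d) ℂ) (ω : Fin d → ℂ) (r : Fin d → ℝ) (p : Polynomial ℝ)

/-- The `l`-th mode of `C p(A) B`, divided by `1 - r_l`. -/
def residualMode (l : Fin d) : Matrix (Fin m) (Fin n) ℂ :=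
  (Polynomial.aeval (ω l * (r l : ℂ)) p / ((1 - r l : ℝ) : ℂ)) • modeMatrix B C Ψ l

variable {ω r p}

theorem sum_frobNorm_residualMode_le {R : ℝ} (hω : ∀ l, ‖ω l‖ = 1) (h0 : ∀ l, 0 ≤ r l)
    (h1 : ∀ l, r l ≤ 1) (hp : ∀ l, Polynomial.aeval (ω l) p = 0)
    (hR : ∑ l, frobNorm (modeMatrix B C Ψ l) ≤ R) :
    ∑ l, frobNorm (residualMode B C Ψ ω r p l) ≤ polyL1 p * p.natDegree * R := by
  have hL : 0 ≤ polyL1 p := sum_nonneg fun _ _ => abs_nonneg _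
  calc _ ≤ ∑ l, polyL1 p * p.natDegree * frobNorm (modeMatrix B C Ψ l) := by
        refine sum_le_sum fun l _ => ?_
        rw [residualMode, frobNorm_smul, norm_div, Complex.norm_real,
          Real.norm_of_nonneg (sub_nonneg.2 (h1 l))]
        refine mul_le_mul_of_nonneg_right (div_le_of_le_mul₀ (sub_nonneg.2 (h1 l))
          (by positivity) ?_) (frobNorm_nonneg _)
        rw [mul_assoc]
        exact norm_aeval_mul_le (hω l) (hp l) (h0 l) (h1 l)
    _ ≤ _ := by rw [← mul_sum]; gcongr

variable {B C Ψ}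

theorem arWeight_add_eq_re {A : Matrix (Fin d) (Fin d) ℝ} (hΨ : IsUnit Ψ.det)
    (hA : A.map (algebraMap ℝ ℂ) = Ψ * Matrix.diagonal (fun l => ω l * (r l : ℂ)) * Ψ⁻¹)
    (hp : ∀ l, Polynomial.aeval (ω l) p = 0) {T : ℕ} (s : Fin T) :
    arWeight A B C p (p.natDegree + s) = (∑ l, (ω l ^ (s : ℕ) * (geomVec T (r l) s : ℂ))
      • residualMode B C Ψ ω r p l).map Complex.re := by
  have h : (∑ l, (ω l ^ (s : ℕ) * (geomVec T (r l) s : ℂ)) • residualMode B C Ψ ω r p l)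
      = (arWeight A B C p (p.natDegree + s)).map (algebraMap ℝ ℂ) := by
    rw [map_arWeight_add B C hΨ hA]
    refine sum_congr rfl fun l _ => ?_
    rw [residualMode, smul_smul, geomVec_apply]
    congr 1
    -- At `r l = 1` the quotient in `residualMode` is a division by zero, but both sides vanish
    -- because `p (ω l) = 0`.
    rcases eq_or_ne (r l) 1 with h1 | h1
    · simp [h1, hp l]
    · have : ((1 - r l : ℝ) : ℂ) ≠ 0 := by
        exact_mod_cast sub_ne_zero.2 h1.symm
      push_cast at this ⊢
      field_simp
      ring
  rw [h]
  ext i j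
  simp

theorem sum_frobNorm_modes_le {ι : Type*} [Fintype ι] {T : ℕ} {ω : ι → ℂ} {r : ι → ℝ}
    (hω : ∀ l, ‖ω l‖ = 1) (h0 : ∀ l, 0 ≤ r l) (h1 : ∀ l, r l ≤ 1)
    (G : ι → Matrix (Fin m) (Fin n) ℂ) :
    ∑ s : Fin T, frobNorm ((∑ l, (ω l ^ (s : ℕ) * (geomVec T (r l) s : ℂ)) • G l).map Complex.re)
      ≤ ∑ l, frobNorm (G l) := by
  calc _ ≤ ∑ s : Fin T, ∑ l, geomVec T (r l) s * frobNorm (G l) := by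
        refine sum_le_sum fun s _ => (frobNorm_map_re_le _).trans
          ((frobNorm_sum_le _ _).trans (sum_le_sum fun l _ => ?_))
        have hgn : 0 ≤ geomVec T (r l) s := by
          rw [geomVec_apply]
          exact mul_nonneg (sub_nonneg.2 (h1 l)) (pow_nonneg (h0 l) _)
        rw [frobNorm_smul, norm_mul, norm_pow, hω, one_pow, one_mul, Complex.norm_real,
          Real.norm_of_nonneg hgn]
    _ ≤ _ := by
        rw [sum_comm]
        refine sum_le_sum fun l _ => ?_
        rw [← sum_mul]
        exact mul_le_of_le_one_left (frobNorm_nonneg _) (sum_geomVec_le_one (h0 l))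

end Modes

/-- Since `z ≤ z ^ 2`, one power of `a` can be traded for a factor `2`; this gives the second bound
on `k`. -/
theorem Real.posLog_sq_mul_le {a z : ℝ} (hz : 1 ≤ z) :
    Real.posLog (a ^ 2 * z) ≤ 2 * Real.posLog (a * z) := by
  have h : Real.posLog (a ^ 2 * z) ≤ Real.posLog ((a * z) ^ 2) := by
    refine Real.posLog_le_posLog (by positivity) ?_
    rw [mul_pow]
    gcongr
    nlinarith
  simpa using h

theorem sum_abs_coeff_le_polyL1 (p : Polynomial ℝ) :
    ∑ u : Fin p.natDegree, |-p.coeff (p.natDegree - ((u : ℕ) + 1))| ≤ polyL1 p := by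
  simp only [abs_neg]
  rw [Fin.sum_univ_eq_sum_range (fun u => |p.coeff (p.natDegree - (u + 1))|), polyL1,
    sum_range_succ]
  refine le_add_of_le_of_nonneg (le_of_eq ?_) (abs_nonneg _)
  rw [← sum_range_reflect]
  refine sum_congr rfl fun u hu => ?_
  have := mem_range.1 hu
  congr 2
  omega

theorem Real.sqrt_sq_add_sq_le_add {a b : ℝ} (ha : 0 ≤ a) (hb : 0 ≤ b) :
    √(a ^ 2 + b ^ 2) ≤ a + b := by
  rw [Real.sqrt_le_iff]
  exact ⟨by positivity, by nlinarith [mul_nonneg ha hb]⟩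

end

/-! ### Assembly of the theorem. -/

set_option maxHeartbeats 1000000 in
theorem mainTheorem2 :
    ∃ K : ℝ, 0 < K ∧
    ∀ (d n m T τ : ℕ)
      (A : Matrix (Fin d) (Fin d) ℝ) (B : Matrix (Fin d) (Fin n) ℝ)
      (C : Matrix (Fin m) (Fin d) ℝ)
      (Ψ : Matrix (Fin d) (Fin d) ℂ) (ω : Fin d → ℂ) (r : Fin d → ℝ)
      (p : Polynomial ℝ) (R₁ RΘ RΨ Rx ε : ℝ)
      (σ : Fin T → ℝ) (φ : Fin T → EuclideanSpace ℝ (Fin T)),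
      -- the diagonalization of `A`, with eigenvalues `ω_ℓ r_ℓ`
      IsUnit Ψ.det →
      (∀ l, ‖ω l‖ = 1) →
      (∀ l, 0 ≤ r l) →
      A.map (algebraMap ℝ ℂ) = Ψ * Matrix.diagonal (fun l => ω l * (r l : ℂ)) * Ψ⁻¹ →
      spectralRadius ℂ (A.map (algebraMap ℝ ℂ)) ≤ 1 →
      -- the polynomial that vanishes on the phases
      p.Monic → p.natDegree = τ →
      (∀ l, Polynomial.aeval (ω l) p = 0) →
      -- the norm bounds
      polyL1 p ≤ R₁ →
      opNorm2 B ≤ RΘ → opNorm2 C ≤ RΘ →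
      frobNorm Ψ * frobNorm Ψ⁻¹ ≤ RΨ →
      0 ≤ Rx → 0 < ε →
      IsWaveFilters T σ φ →
      ∃ (k W : ℕ) (hk : k ≤ T) (Θ : PseudoLDS W k τ m n),
        (k : ℝ) ≤ K * (Real.log T * Real.posLog (τ * RΘ ^ 2 * RΨ * R₁ * Rx * T / ε)) ∧
        (ε ≤ τ * RΨ * R₁ * Rx * T →
          (k : ℝ) ≤ K * (Real.log T * Real.posLog (τ * RΘ * RΨ * R₁ * Rx * T / ε))) ∧
        (W : ℝ) ≤ K * (τ * RΘ ^ 2 * RΨ * R₁ * Rx * (T : ℝ) ^ (3 / 2 : ℝ) / ε) ∧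
        ∑ u, |Θ.e u| ≤ R₁ ∧
        (∀ j, frobNorm (Θ.P j) ≤ R₁ * RΘ ^ 2 * RΨ) ∧
        Real.sqrt (tensorNorm21 Θ.M ^ 2 + tensorNorm21 Θ.N ^ 2)
          ≤ K * (RΘ ^ 2 * RΨ * R₁ * τ * Real.sqrt k) ∧
        ∀ x : ℕ → EuclideanSpace ℝ (Fin n), (∀ t ∈ Finset.Icc 1 T, ‖x t‖ ≤ Rx) →
          ∀ t ∈ Finset.Icc 1 T,
            ‖Θ.predict hk σ φ x (ldsOutput A B C x) t - ldsOutput A B C x t‖ ≤ ε := by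
  refine ⟨120, by norm_num, ?_⟩
  intro d n m T τ A B C Ψ ω r p R₁ RΘ RΨ Rx ε σ φ hΨ hω hr hA hρ hp hτ hroot hR₁ hB hC hRΨ hRx hε hφ
  subst hτ
  have hRΘ : 0 ≤ RΘ := (opNorm2_nonneg B).trans hB
  have hRΨ0 : 0 ≤ RΨ := (mul_nonneg (frobNorm_nonneg _) (frobNorm_nonneg _)).trans hRΨ
  have hR₁0 : 0 ≤ R₁ := zero_le_one.trans ((one_le_polyL1 hp).trans hR₁)
  have hα : ∀ l, ‖ω l * (r l : ℂ)‖ ≤ 1 := norm_le_one_of_spectralRadius_le hΨ hA hρ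
  have hr1 : ∀ l, r l ≤ 1 := fun l => by
    simpa [hω l, abs_of_nonneg (hr l)] using hα l
  have hmodes := sum_frobNorm_modeMatrix_le B C Ψ hB hC hRΨ
  have hP : ∀ j, frobNorm (arWeight A B C p j) ≤ R₁ * RΘ ^ 2 * RΨ := fun j => by
    refine (frobNorm_arWeight_le B C hΨ hA hα hmodes p j).trans ?_
    rw [mul_assoc]
    gcongr
  have he := (sum_abs_coeff_le_polyL1 p).trans hR₁
  set G := residualMode B C Ψ ω r p with hG
  set S := ∑ l, frobNorm (G l) with hS
  -- `X` bounds the ratio of the total residual to `ε`, so a relative error `1 / X` is enough.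
  set X := p.natDegree * RΘ ^ 2 * RΨ * R₁ * Rx / ε with hX
  have hX0 : 0 ≤ X := by positivity
  have hSle : S ≤ R₁ * p.natDegree * (RΘ ^ 2 * RΨ) :=
    (sum_frobNorm_residualMode_le B C Ψ hω hr hr1 hroot hmodes).trans (by gcongr)
  have hS0 : 0 ≤ S := sum_nonneg fun _ _ => frobNorm_nonneg _
  have hSX : S * Rx ≤ X * ε := by
    calc S * Rx ≤ R₁ * p.natDegree * (RΘ ^ 2 * RΨ) * Rx := by gcongr
      _ = X * ε := by rw [hX]; field_simp
  have hXT : p.natDegree * RΘ ^ 2 * RΨ * R₁ * Rx * T / ε = X * T := by rw [hX]; ring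
  have hlogT : 0 ≤ Real.log T := Real.log_natCast_nonneg T
  by_cases hcase : 1 < X ∧ 2 ≤ T
  · obtain ⟨hX1, hT⟩ := hcase
    have hT2 : (2 : ℝ) ≤ T := by exact_mod_cast hT
    obtain ⟨k, hk, hkle, hη⟩ := hφ.exists_card_filters hT hX1
    -- Makes the phase error `2π T / W` at most `1 / (2 X)`, matching the filter error. This `W` is
    -- linear in `T`, within the allowed `T ^ (3 / 2)`.
    set W := ⌈4 * Real.pi * X * T⌉₊ with hW
    have hpi := Real.pi_pos
    have hW0 : 0 < W := Nat.ceil_pos.2 (by positivity)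
    have hWlow : 4 * Real.pi * X * T ≤ W := Nat.le_ceil _
    have hWup : (W : ℝ) ≤ 14 * (X * T) := by
      have := Nat.ceil_lt_add_one (a := 4 * Real.pi * X * T) (by positivity)
      have := Real.pi_lt_d2
      have hXT2 : 2 ≤ X * T := by nlinarith
      nlinarith
    obtain ⟨M, N, hM, hN, hMN⟩ := hφ.exists_filterWeight_near hk hW0 ω r G hω hr hr1 hη
    have hM0 : 0 ≤ tensorNorm21 M := sum_nonneg fun _ _ => Real.sqrt_nonneg _
    have hN0 : 0 ≤ tensorNorm21 N := sum_nonneg fun _ _ => Real.sqrt_nonneg _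
    have hklog : (k : ℝ) ≤ 60 * (Real.log T * Real.posLog (X * T)) := by
      refine hkle.trans ?_
      gcongr
      exact le_max_right _ _
    refine ⟨k, W, hk, ⟨M, N, fun u => -p.coeff (p.natDegree - ((u : ℕ) + 1)),
      fun j => arWeight A B C p j⟩, ?_, fun hεle => ?_, ?_, he, fun j => hP j, ?_, ?_⟩
    · rw [hXT]
      have : 0 ≤ Real.log T * Real.posLog (X * T) := mul_nonneg hlogT Real.posLog_nonneg
      linarith
    · have hz : 1 ≤ p.natDegree * RΨ * R₁ * Rx * T / ε := (one_le_div hε).2 hεle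
      have h2 := Real.posLog_sq_mul_le (a := RΘ) hz
      have e1 : RΘ ^ 2 * (p.natDegree * RΨ * R₁ * Rx * T / ε) = X * T := by rw [hX]; ring
      have e2 : RΘ * (p.natDegree * RΨ * R₁ * Rx * T / ε)
          = p.natDegree * RΘ * RΨ * R₁ * Rx * T / ε := by ring
      rw [e1, e2] at h2
      nlinarith
    · have hT32 : (T : ℝ) ≤ (T : ℝ) ^ (3 / 2 : ℝ) := by
        conv_lhs => rw [← Real.rpow_one (T : ℝ)]
        exact Real.rpow_le_rpow_of_exponent_le (by linarith) (by norm_num)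
      have e : p.natDegree * RΘ ^ 2 * RΨ * R₁ * Rx * (T : ℝ) ^ (3 / 2 : ℝ) / ε
          = X * (T : ℝ) ^ (3 / 2 : ℝ) := by rw [hX]; ring
      rw [e]
      have : X * T ≤ X * (T : ℝ) ^ (3 / 2 : ℝ) := by gcongr
      have : 0 ≤ X * (T : ℝ) := by positivity
      linarith
    · have hb : 2 * √k * S ≤ 2 * √k * (R₁ * p.natDegree * (RΘ ^ 2 * RΨ)) := by gcongr
      have hb0 : 0 ≤ RΘ ^ 2 * RΨ * R₁ * p.natDegree * √k := by positivity
      exact (Real.sqrt_sq_add_sq_le_add hM0 hN0).trans (by linarith)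
    · intro x hx t ht
      rw [Finset.mem_Icc] at ht
      rw [PseudoLDS.predict_sub_eq hp A B C _ (fun _ => rfl) (fun _ => rfl) hk σ φ x ht.1 ht.2]
      refine (norm_sum_toEuclideanLin_delayed_le _ hRx hx ht.2).trans ?_
      simp only [arWeight_add_eq_re hΨ hA hroot]
      have hphase : 2 * Real.pi * T / W ≤ 1 / (2 * X) := by
        rw [div_le_div_iff₀ (by exact_mod_cast hW0) (by positivity)]
        linarith
      calc _ ≤ (2 * Real.pi * T / W + 1 / (2 * X)) * S * Rx := by gcongr
        _ ≤ (1 / (2 * X) + 1 / (2 * X)) * (X * ε) := by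
            rw [mul_assoc]
            gcongr
        _ = ε := by field_simp; norm_num
  -- No filters are needed: either the whole residual is at most `ε`, or `T ≤ 1` and no input
  -- reaches it.
  · refine ⟨0, 0, Nat.zero_le T, ⟨fun _ _ => 0, fun _ _ => 0,
      fun u => -p.coeff (p.natDegree - ((u : ℕ) + 1)), fun j => arWeight A B C p j⟩,
      ?_, fun _ => ?_, ?_, he, fun j => hP j, ?_, ?_⟩
    · rw [Nat.cast_zero]
      exact mul_nonneg (by norm_num) (mul_nonneg hlogT Real.posLog_nonneg)
    · rw [Nat.cast_zero]
      exact mul_nonneg (by norm_num) (mul_nonneg hlogT Real.posLog_nonneg)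
    · rw [Nat.cast_zero]
      positivity
    · simp [tensorNorm21]
    · intro x hx t ht
      rw [Finset.mem_Icc] at ht
      rw [PseudoLDS.predict_sub_eq hp A B C _ (fun _ => rfl) (fun _ => rfl) _ σ φ x ht.1 ht.2]
      rcases le_or_gt X 1 with hX1 | hX1
      · refine (norm_sum_toEuclideanLin_delayed_le _ hRx hx ht.2).trans ?_
        have hw : ∀ s, frobNorm (filterWeight (W := 0) (Nat.zero_le T) σ φ (fun _ _ => 0)
            (fun _ _ => 0) s - arWeight A B C p (p.natDegree + s))
            = frobNorm ((∑ l, (ω l ^ (s : ℕ) * (geomVec T (r l) s : ℂ)) • G l).map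
              Complex.re) := fun s => by
          rw [filterWeight, univ_eq_empty, sum_empty, zero_sub, frobNorm_neg,
            arWeight_add_eq_re hΨ hA hroot]
        simp only [hw]
        calc _ ≤ S * Rx := by
              gcongr
              exact sum_frobNorm_modes_le hω hr hr1 G
          _ ≤ X * ε := hSX
          _ ≤ ε := mul_le_of_le_one_left hε.le hX1
      · have hT : T < 2 := by
          by_contra h
          exact hcase ⟨hX1, not_lt.1 h⟩
        -- Here `1 < X` forces `τ ≥ 1`, so every delay `τ + s` is at least `1 ≥ t` and the delayed
        -- inputs are zero.
        have hdeg : p.natDegree ≠ 0 := fun h => by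
          rw [hX, h] at hX1
          norm_num at hX1
        rw [sum_eq_zero fun s _ => by rw [delayed, if_neg (by omega), map_zero], norm_zero]
        exact hε.le
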